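/- **Setting.** All von Neumann algebras $\mathcal A\subset B(\mathcal G)$ are taken in standard form: there are a conjugate-linear involution $J$ with $\langle x,Jy\rangle=\langle y,Jx\rangle$ and $\mathcal A'=J\mathcal AJ$, and a closed convex cone $\mathcal P\subset\mathcal G$ with $Jx=x$ on $\mathcal P$, such that a vector of $\mathcal P$ is cyclic iff it is separating, and such that every normal state $\mu$ has a unique representing vector $\Lambda_\mu\in\mathcal P$, $\mu(a)=\langle\Lambda_\mu,a\Lambda_\mu\rangle$. A *$\mathbb Z_2$-graded system* $\mathbf A=(\mathcal A,\alpha,\mu,k)$ consists of such an $\mathcal A$ with a $*$-automorphism $\gamma_{\mathcal A}$, $\gamma_{\mathcal A}^2=\mathrm{id}$; a faithful normal state $\mu$ with $\mu\circ\gamma_{\mathcal A}=\mu$; unital positive linear maps $\alpha_\upsilon:\mathcal A\to\mathcal A$ ($\upsilon\in\Upsilon$) with $\alpha_\upsilon\gamma_{\mathcal A}=\gamma_{\mathcal A}\alpha_\upsilon$ and $\mu\circ\alpha_\upsilon=\mu$; and coordinates $k_1,\dots,k_d\in\mathcal A$. The index set $\Upsilon$ and $d\ge1$ are arbitrary, but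 the same for all systems. Let $\mathbf B=(\mathcal B,\beta,\nu,l)$ denote a second system; $\mathcal A$ and $\mathcal B$ may act on different Hilbert spaces. *Twisted commutant.* Let $g_{\mathcal B}$ be the unitary with $g_{\mathcal B}\,b\Lambda_\nu=\gamma_{\mathcal B}(b)\Lambda_\nu$ and let $g_{\mathcal B}^{1/2}=p^+-ip^-$ with $p^\pm=(1\pm g_{\mathcal B})/2$. Put $\mathcal B^\wr=g_{\mathcal B}^{1/2}\mathcal B'g_{\mathcal B}^{-1/2}$, with grading $c\mapsto g_{\mathcal B}cg_{\mathcal B}$ and state $\nu^\wr(c)=\langle\Lambda_\nu,c\Lambda_\nu\rangle$. For an even unital positive map $E:\mathcal A\to\mathcal B$ (i.e. $E\gamma_{\mathcal A}=\gamma_{\mathcal B}E$) with $\nu\circ E=\mu$, its twisted dual $E^\wr:\mathcal B^\wr\to\mathcal A^\wr$ is the unique positive linear map with $\langle\Lambda_\mu,a\,E^\wr(c)\Lambda_\mu\rangle=\langle\Lambda_\nu,E(a)c\,\Lambda_\nu\rangle$ for all $a\in\mathcal A$, $c\in\mathcal B^\wr$. *Fermionic transport plans.* The Fermi tensor product $\mathcal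 A\otimes_F\mathcal B^\wr$ is the algebraic tensor product with, for homogeneous elements, $(a\otimes b)(c\otimes d)=(-1)^{|b||c|}ac\otimes bd$ and $(a\otimes b)^*=(-1)^{|a||b|}a^*\otimes b^*$. $T^F(\mathbf A,\mathbf B)$ is the set of linear functionals $\omega$ on it with $\omega(1)=1$, $\omega(c^*c)\ge0$ for all $c$, and, for all $a\in\mathcal A$, $b\in\mathcal B^\wr$, $\upsilon\in\Upsilon$, $$\omega(a\otimes1)=\mu(a),\quad \omega(1\otimes b)=\nu^\wr(b),\quad \omega(\gamma_{\mathcal A}(a)\otimes b)=\omega(a\otimes\gamma_{\mathcal B}^\wr(b)),\quad \omega(\alpha_\upsilon(a)\otimes b)=\omega(a\otimes\beta_\upsilon^\wr(b)).$$ Each such $\omega$ has a unique channel $E_\omega:\mathcal A\to\mathcal B$ with $\omega(a\otimes b)=\langle\Lambda_\nu,E_\omega(a)b\,\Lambda_\nu\rangle$ for all $a,b$. *Distance.* $W^F(\mathbf A,\mathbf B)=\inf_{\omega\in T^F(\mathbf A,\mathbf B)}I_{\mathbf A,\mathbf B}(\omega)^{1/2}$, where $$I_{\mathbf A,\mathbf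 B}(\omega)=\sum_{i=1}^d\big[\mu(k_i^*k_i)+\nu(l_i^*l_i)-\nu(E_\omega(k_i)^*l_i)-\nu(l_i^*E_\omega(k_i))\big].$$ $\mathbf A$ is *hermitian* if $\{k_1^*,\dots,k_d^*\}=\{k_1,\dots,k_d\}$. $\mathbf A$ and $\mathbf B$ are *isomorphic* if there is a $*$-isomorphism $\iota:\mathcal A\to\mathcal B$ with $\iota\gamma_{\mathcal A}=\gamma_{\mathcal B}\iota$, $\iota\alpha_\upsilon=\beta_\upsilon\iota$ for all $\upsilon$, $\nu\circ\iota=\mu$ and $\iota(k_i)=l_i$ for all $i$. **Proposition.** Let $\mathbf A$ and $\mathbf B$ be hermitian $\mathbb Z_2$-graded systems such that $\mathcal A$ is generated, as a von Neumann algebra, by $k_1,\dots,k_d$, and $\mathcal B$ by $l_1,\dots,l_d$. If $W^F(\mathbf A,\mathbf B)=0$ and $W^F(\mathbf B,\mathbf A)=0$, then $\mathbf A$ and $\mathbf B$ are isomorphic. -/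

import Mathlib

set_option linter.unusedSectionVars false
set_option linter.unusedSimpArgs false
set_option linter.unnecessarySeqFocus false

open scoped TensorProduct InnerProductSpace ComplexConjugate ComplexOrder

noncomputable section

namespace FermiTransport

universe u v w

/-! ### The algebraic Fermi tensor product of two `ℤ₂`-graded `*`-algebras

A `ℤ₂`-grading is an involutive `*`-automorphism `γ`; the even and odd elements are its
eigenvectors for `1` and `-1`. -/

section FermiTensor

variable {A : Type u} [Ring A] [StarRing A] [Algebra ℂ A] [StarModule ℂ A]
variable {B : Type v} [Ring B] [StarRing B] [Algebra ℂ B] [StarModule ℂ B]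

/-- The even part `a₊ = (a + γ(a)) / 2`. -/
def evenPart (γ : A →⋆ₐ[ℂ] A) : A →ₗ[ℂ] A :=
  (2⁻¹ : ℂ) • (LinearMap.id + γ.toAlgHom.toLinearMap)

/-- The odd part `a₋ = (a - γ(a)) / 2`. -/
def oddPart (γ : A →⋆ₐ[ℂ] A) : A →ₗ[ℂ] A :=
  (2⁻¹ : ℂ) • (LinearMap.id - γ.toAlgHom.toLinearMap)

theorem evenPart_apply (γ : A →⋆ₐ[ℂ] A) (a : A) : evenPart γ a = (2⁻¹ : ℂ) • (a + γ a) := rfl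

theorem oddPart_apply (γ : A →⋆ₐ[ℂ] A) (a : A) : oddPart γ a = (2⁻¹ : ℂ) • (a - γ a) := rfl

/-- The product of the Fermi tensor product, on the vector space `A ⊗ B`:
`(a ⊗ b)(c ⊗ d) = (-1)^(|b||c|) ac ⊗ bd` for homogeneous `b` and `c`. In terms of the grading `γA`
this says `(a ⊗ b)(c ⊗ d) = ac ⊗ bd` for even `b` and `(a ⊗ b)(c ⊗ d) = a γA(c) ⊗ bd` for
odd `b`. -/
def fermiMul (γA : A →⋆ₐ[ℂ] A) (γB : B →⋆ₐ[ℂ] B) : A ⊗[ℂ] B →ₗ[ℂ] A ⊗[ℂ] B →ₗ[ℂ] A ⊗[ℂ] B :=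
  TensorProduct.map₂ (LinearMap.mul ℂ A) (LinearMap.mul ℂ B ∘ₗ evenPart γB) +
    TensorProduct.map₂ ((LinearMap.mul ℂ A).compl₂ γA.toAlgHom.toLinearMap)
      (LinearMap.mul ℂ B ∘ₗ oddPart γB)

/-- The involution of the Fermi tensor product, on the vector space `A ⊗ B`:
`(a ⊗ b)* = (-1)^(|a||b|) a* ⊗ b*` for homogeneous `a` and `b`; that is,
`(a ⊗ b)* = a* ⊗ b*` for even `b` and `(a ⊗ b)* = γA(a)* ⊗ b*` for odd `b`. -/
def fermiStar (γA : A →⋆ₐ[ℂ] A) (γB : B →⋆ₐ[ℂ] B) (c : A ⊗[ℂ] B) : A ⊗[ℂ] B :=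
  star (TensorProduct.map LinearMap.id (evenPart γB) c +
    TensorProduct.map γA.toAlgHom.toLinearMap (oddPart γB) c)

theorem fermiMul_tmul (γA : A →⋆ₐ[ℂ] A) (γB : B →⋆ₐ[ℂ] B) (a c : A) (b d : B) :
    fermiMul γA γB (a ⊗ₜ b) (c ⊗ₜ d) =
      (a * c) ⊗ₜ[ℂ] (evenPart γB b * d) + (a * γA c) ⊗ₜ[ℂ] (oddPart γB b * d) := rfl

theorem fermiStar_tmul (γA : A →⋆ₐ[ℂ] A) (γB : B →⋆ₐ[ℂ] B) (a : A) (b : B) :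
    fermiStar γA γB (a ⊗ₜ b) =
      star a ⊗ₜ[ℂ] star (evenPart γB b) + star (γA a) ⊗ₜ[ℂ] star (oddPart γB b) := by
  simp [fermiStar]

theorem fermiStar_add (γA : A →⋆ₐ[ℂ] A) (γB : B →⋆ₐ[ℂ] B) (x y : A ⊗[ℂ] B) :
    fermiStar γA γB (x + y) = fermiStar γA γB x + fermiStar γA γB y := by
  simp only [fermiStar, map_add, star_add]; abel

/-- On homogeneous elements the product is the sign-twisted one. -/
theorem fermiMul_homogeneous (γA : A →⋆ₐ[ℂ] A) (γB : B →⋆ₐ[ℂ] B) (a c : A) (b d : B)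
    (p q : ℕ) (hb : γB b = (-1 : ℂ) ^ p • b) (hc : γA c = (-1 : ℂ) ^ q • c) :
    fermiMul γA γB (a ⊗ₜ b) (c ⊗ₜ d) = (-1 : ℂ) ^ (p * q) • ((a * c) ⊗ₜ[ℂ] (b * d)) := by
  rw [fermiMul_tmul, evenPart_apply, oddPart_apply, hb, hc]
  rcases Nat.even_or_odd p with hp | hp
  · have : (-1 : ℂ) ^ (p * q) = 1 := (hp.mul_right q).neg_one_pow
    rw [this, hp.neg_one_pow, one_smul, sub_self, ← two_smul ℂ b, smul_smul]
    norm_num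
  · rw [pow_mul, hp.neg_one_pow, neg_one_smul, add_neg_cancel, sub_neg_eq_add, ← two_smul ℂ b,
      smul_smul]
    norm_num [TensorProduct.smul_tmul']

/-- On homogeneous elements the involution is the sign-twisted one. -/
theorem fermiStar_homogeneous (γA : A →⋆ₐ[ℂ] A) (γB : B →⋆ₐ[ℂ] B) (a : A) (b : B)
    (p q : ℕ) (ha : γA a = (-1 : ℂ) ^ p • a) (hb : γB b = (-1 : ℂ) ^ q • b) :
    fermiStar γA γB (a ⊗ₜ b) = (-1 : ℂ) ^ (p * q) • (star a ⊗ₜ[ℂ] star b) := by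
  rw [fermiStar_tmul, evenPart_apply, oddPart_apply, ha, hb]
  rcases Nat.even_or_odd q with hq | hq
  · have : (-1 : ℂ) ^ (p * q) = 1 := (hq.mul_left p).neg_one_pow
    rw [this, hq.neg_one_pow, one_smul, sub_self, ← two_smul ℂ b, smul_smul]
    norm_num
  · rw [mul_comm p q, pow_mul, hq.neg_one_pow, neg_one_smul, add_neg_cancel, sub_neg_eq_add,
      ← two_smul ℂ b, smul_smul]
    norm_num [TensorProduct.smul_tmul']

/-- A state on the Fermi tensor product, regarded as a unital `*`-algebra. -/
structure IsFermiState (γA : A →⋆ₐ[ℂ] A) (γB : B →⋆ₐ[ℂ] B) (ω : A ⊗[ℂ] B →ₗ[ℂ] ℂ) : Prop where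
  map_one : ω (1 ⊗ₜ 1) = 1
  nonneg : ∀ c : A ⊗[ℂ] B, 0 ≤ ω (fermiMul γA γB (fermiStar γA γB c) c)

end FermiTensor

/-! ### States and standard forms of von Neumann algebras -/

section VonNeumann

variable {H : Type u} [NormedAddCommGroup H] [InnerProductSpace ℂ H] [CompleteSpace H]

/-- The `*`-algebra underlying a von Neumann algebra. -/
abbrev Alg (M : VonNeumannAlgebra H) : Type u := M.toStarSubalgebra

/-- `x` is cyclic for `M`: the subspace `M x` is dense. -/
def IsCyclic (M : VonNeumannAlgebra H) (x : H) : Prop :=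
  Dense {y : H | ∃ a ∈ M, y = a x}

/-- `x` is separating for `M`. -/
def IsSeparating (M : VonNeumannAlgebra H) (x : H) : Prop :=
  ∀ a ∈ M, a x = 0 → a = 0

/-- A normal (that is, `σ`-weakly continuous) state on `M`. -/
structure IsNormalState (M : VonNeumannAlgebra H) (φ : Alg M →ₗ[ℂ] ℂ) : Prop where
  map_one : φ 1 = 1
  nonneg : ∀ a : Alg M, 0 ≤ φ (star a * a)
  normal : ∃ ξ η : ℕ → H, (Summable fun n => ‖ξ n‖ ^ 2) ∧ (Summable fun n => ‖η n‖ ^ 2) ∧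
    ∀ a : Alg M, HasSum (fun n => ⟪ξ n, (a : H →L[ℂ] H) (η n)⟫_ℂ) (φ a)

/-- A faithful normal state on `M`. -/
structure IsFaithfulNormalState (M : VonNeumannAlgebra H) (φ : Alg M →ₗ[ℂ] ℂ) : Prop
    extends IsNormalState M φ where
  faithful : ∀ a : Alg M, φ (star a * a) = 0 → a = 0

/-- A standard form of `M` on `H`: a modular conjugation `J` and a positive cone `P`. -/
structure StandardForm (M : VonNeumannAlgebra H) where
  /-- the modular conjugation -/
  J : H →ₗ⋆[ℂ] H
  J_J : ∀ x, J (J x) = x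
  J_selfAdjoint : ∀ x y, ⟪x, J y⟫_ℂ = ⟪y, J x⟫_ℂ
  J_conj : ∀ T : H →L[ℂ] H, T ∈ M.commutant ↔ ∃ a ∈ M, ∀ x, T x = J (a (J x))
  /-- the positive cone -/
  P : Set H
  isClosed_P : IsClosed P
  add_mem_P : ∀ x ∈ P, ∀ y ∈ P, x + y ∈ P
  smul_mem_P : ∀ x ∈ P, ∀ r : ℝ, 0 ≤ r → (r : ℂ) • x ∈ P
  J_eq_of_mem_P : ∀ x ∈ P, J x = x
  cyclic_iff_separating : ∀ x ∈ P, IsCyclic M x ↔ IsSeparating M x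
  existsUnique_vector : ∀ φ : Alg M →ₗ[ℂ] ℂ, IsNormalState M φ →
    ∃! x : H, x ∈ P ∧ ∀ a : Alg M, φ a = ⟪x, (a : H →L[ℂ] H) x⟫_ℂ

/-- The linear map `a ↦ a x`. -/
def evalAt (M : VonNeumannAlgebra H) (x : H) : Alg M →ₗ[ℂ] H where
  toFun a := (a : H →L[ℂ] H) x
  map_add' _ _ := rfl
  map_smul' _ _ := rfl

theorem evalAt_apply (M : VonNeumannAlgebra H) (x : H) (a : Alg M) :
    evalAt M x a = (a : H →L[ℂ] H) x := rfl

theorem IsCyclic.denseRange {M : VonNeumannAlgebra H} {x : H} (h : IsCyclic M x) :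
    DenseRange (evalAt M x) := by
  refine h.mono ?_
  rintro y ⟨a, ha, rfl⟩
  exact ⟨⟨a, ha⟩, rfl⟩

theorem norm_sq_le_of_nonneg {M : VonNeumannAlgebra H} (φ : Alg M →ₗ[ℂ] ℂ)
    (hφ : ∀ a, 0 ≤ φ (star a * a)) (a b : Alg M) :
    ‖φ (star a * b)‖ ^ 2 ≤ (φ (star a * a)).re * (φ (star b * b)).re := by
  let c : PreInnerProductSpace.Core ℂ (Alg M) :=
    { inner := fun a b => φ (star a * b)
      conj_inner_symm := fun a b => by
        have him : ∀ z : ℂ, 0 ≤ z → z.im = 0 := fun z hz => (Complex.le_def.1 hz).2.symm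
        have h0 := him _ (hφ a)
        have h0' := him _ (hφ b)
        have h1 := him _ (hφ (a + b))
        have h2 := him _ (hφ (a + Complex.I • b))
        simp only [star_add, add_mul, mul_add, map_add, star_smul, smul_mul_assoc, mul_smul_comm,
          map_smul, smul_eq_mul, Complex.add_im, Complex.mul_im, Complex.mul_re, Complex.I_re,
          Complex.I_im, RCLike.star_def, Complex.conj_I, Complex.neg_re, Complex.neg_im, h0, h0']
          at h1 h2
        apply Complex.ext
        · simp only [Complex.conj_re]; linarith
        · simp only [Complex.conj_im]; linarith
      re_inner_nonneg := fun a => (Complex.le_def.1 (hφ a)).1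
      add_left := fun a b c => by simp [add_mul]
      smul_left := fun a b r => by simp }
  have h := @InnerProductSpace.Core.inner_mul_inner_self_le ℂ (Alg M) _ _ _ c a b
  have hs : φ (star b * a) = conj (φ (star a * b)) := (c.conj_inner_symm b a).symm
  change ‖φ (star a * b)‖ * ‖φ (star b * a)‖ ≤ (φ (star a * a)).re * (φ (star b * b)).re at h
  rw [hs, RCLike.norm_conj] at h
  rwa [sq]

/-- A positive functional on `M` that is dominated by the vector functional of a cyclic vector
is given by a positive operator in the commutant. -/
theorem exists_commutant_of_dominated {M : VonNeumannAlgebra H} {x : H} (hx : IsCyclic M x)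
    (φ : Alg M →ₗ[ℂ] ℂ) (C : ℝ) (hφ : ∀ a, 0 ≤ φ (star a * a))
    (hC : ∀ a, (φ (star a * a)).re ≤ C * ‖evalAt M x a‖ ^ 2) :
    ∃ T ∈ M.commutant, T.IsPositive ∧ ∀ a : Alg M, φ a = ⟪x, (a : H →L[ℂ] H) (T x)⟫_ℂ := by
  wlog hC0 : 0 ≤ C generalizing C
  · exact this 0 (fun a => (hC a).trans (by
      rw [zero_mul]; exact mul_nonpos_of_nonpos_of_nonneg (by linarith) (by positivity))) le_rfl
  have hd := hx.denseRange
  set e := evalAt M x with he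
  have bound : ∀ a b : Alg M, ‖φ (star a * b)‖ ≤ C * ‖e a‖ * ‖e b‖ := by
    intro a b
    refine le_of_sq_le_sq ?_ (by positivity)
    refine (norm_sq_le_of_nonneg φ hφ a b).trans ?_
    calc (φ (star a * a)).re * (φ (star b * b)).re
        ≤ (C * ‖e a‖ ^ 2) * (C * ‖e b‖ ^ 2) := by
          gcongr
          · exact (Complex.le_def.1 (hφ b)).1
          · exact hC a
          · exact hC b
      _ = _ := by ring
  have hv : ∀ y : Alg M, ∃ v : H, ‖v‖ ≤ C * ‖e y‖ ∧ ∀ b, ⟪v, e b⟫_ℂ = φ (star y * b) := by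
    intro y
    let F : Alg M →ₗ[ℂ] ℂ := φ ∘ₗ LinearMap.mulLeft ℂ (star y)
    have hF : ∀ b, ‖F b‖ ≤ C * ‖e y‖ * ‖e b‖ := bound y
    refine ⟨(InnerProductSpace.toDual ℂ H).symm (F.extendOfNorm e), ?_, fun b => ?_⟩
    · rw [LinearIsometryEquiv.norm_map]
      exact LinearMap.opNorm_extendOfNorm_le hd (by positivity) hF
    · rw [InnerProductSpace.toDual_symm_apply, LinearMap.extendOfNorm_eq hd ⟨_, hF⟩]
      rfl
  choose t htn ht using hv
  have huniq : ∀ v w : H, (∀ b, ⟪v, e b⟫_ℂ = ⟪w, e b⟫_ℂ) → v = w := by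
    intro v w h
    refine ext_inner_right ℂ fun z => ?_
    exact hd.induction_on z (isClosed_eq (by fun_prop) (by fun_prop)) h
  let T0 : Alg M →ₗ[ℂ] H :=
    { toFun := t
      map_add' := fun a b => huniq _ _ fun c => by
        rw [inner_add_left, ht, ht, ht, star_add, add_mul, map_add]
      map_smul' := fun r a => huniq _ _ fun c => by
        rw [RingHom.id_apply, inner_smul_left, ht, ht, star_smul, smul_mul_assoc, map_smul]
        rfl }
  set T : H →L[ℂ] H := T0.extendOfNorm e with hT
  have hTe : ∀ a, T (e a) = t a := fun a => LinearMap.extendOfNorm_eq hd ⟨C, htn⟩ a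
  have hcomm : T ∈ M.commutant := by
    rw [VonNeumannAlgebra.mem_commutant_iff]
    intro a ha
    ext z
    refine hd.induction_on z (isClosed_eq (by fun_prop) (by fun_prop)) fun y => ?_
    let a' : Alg M := ⟨a, ha⟩
    have h1 : a (e y) = e (a' * y) := rfl
    rw [mul_apply_eq_comp, mul_apply_eq_comp, h1, hTe, hTe]
    refine huniq _ _ fun b => ?_
    have h2 : ContinuousLinearMap.adjoint a (e b) = e (star a' * b) := rfl
    rw [← ContinuousLinearMap.adjoint_inner_right, h2, ht, ht, star_mul, mul_assoc]
  have hpos : T.IsPositive := by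
    rw [ContinuousLinearMap.isPositive_iff_complex]
    have : ∀ z, 0 ≤ ⟪T z, z⟫_ℂ := fun z => by
      refine hd.induction_on z (isClosed_le (by fun_prop) (by fun_prop)) fun y => ?_
      rw [hTe, ht]
      exact hφ y
    intro z
    obtain ⟨h1, h2⟩ := Complex.le_def.1 (this z)
    exact ⟨Complex.ext (by simp) (by simpa using h2), h1⟩
  refine ⟨T, hcomm, hpos, fun a => ?_⟩
  have h1 : T x = t 1 := hTe 1
  have h2 := (VonNeumannAlgebra.mem_commutant_iff.1 hcomm) _ a.2
  have h3 := ht 1 a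
  rw [star_one, one_mul, ← h1] at h3
  rw [← h3, ← mul_apply_eq_comp, h2, mul_apply_eq_comp]
  exact hpos.isSymmetric x _

theorem inner_mul_nonneg {S T : H →L[ℂ] H} (hS : S.IsPositive) (hT : T.IsPositive)
    (h : S * T = T * S) (x : H) : 0 ≤ ⟪x, S (T x)⟫_ℂ := by
  rw [← ContinuousLinearMap.nonneg_iff_isPositive] at hS hT
  have := Commute.mul_nonneg hS hT h
  rw [ContinuousLinearMap.nonneg_iff_isPositive] at this
  exact this.inner_nonneg_right x

theorem norm_smul_one_sub_isPositive {T : H →L[ℂ] H} (hT : IsSelfAdjoint T) :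
    ((‖T‖ : ℂ) • 1 - T).IsPositive := by
  have := sub_nonneg.2 hT.le_algebraMap_norm_self
  rw [ContinuousLinearMap.nonneg_iff_isPositive, Algebra.algebraMap_eq_smul_one] at this
  convert this using 2
  ext; simp

theorem induction_isPositive (M : VonNeumannAlgebra H) (p : (H →L[ℂ] H) → Prop)
    (hpos : ∀ T ∈ M, T.IsPositive → p T) (hadd : ∀ S ∈ M, ∀ T ∈ M, p S → p T → p (S + T))
    (hsmul : ∀ (c : ℂ), ∀ T ∈ M, p T → p (c • T)) {T : H →L[ℂ] H} (hT : T ∈ M) : p T := by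
  have smul_mem : ∀ (c : ℂ), ∀ S ∈ M, c • S ∈ M := fun c S hS =>
    M.toStarSubalgebra.smul_mem hS c
  have hsa : ∀ S ∈ M, IsSelfAdjoint S → p S := by
    intro S hS hs
    have h1 : (‖S‖ : ℂ) • (1 : H →L[ℂ] H) ∈ M := smul_mem _ _ (one_mem M)
    have h2 : (‖S‖ : ℂ) • (1 : H →L[ℂ] H) - S ∈ M := sub_mem h1 hS
    have h3 : p ((‖S‖ : ℂ) • (1 : H →L[ℂ] H)) :=
      hsmul _ _ (one_mem M) (hpos _ (one_mem M) ContinuousLinearMap.isPositive_one)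
    have h4 := hsmul (-1) _ h2 (hpos _ h2 (norm_smul_one_sub_isPositive hs))
    have := hadd _ h1 _ (smul_mem _ _ h2) h3 h4
    simpa using this
  have hst : star T ∈ M := star_mem hT
  have e : T = (2⁻¹ : ℂ) • (T + star T) +
      (-(2⁻¹ : ℂ) * Complex.I) • (Complex.I • (T - star T)) := by
    have : -(2⁻¹ : ℂ) * Complex.I * Complex.I = 2⁻¹ := by
      rw [mul_assoc, Complex.I_mul_I]; norm_num
    rw [smul_smul, this]
    module
  rw [e]
  refine hadd _ (smul_mem _ _ (add_mem hT hst)) _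
    (smul_mem _ _ (smul_mem _ _ (sub_mem hT hst)))
    (hsmul _ _ (add_mem hT hst) (hsa _ (add_mem hT hst) ?_))
    (hsmul _ _ (smul_mem _ _ (sub_mem hT hst)) (hsa _ (smul_mem _ _ (sub_mem hT hst)) ?_))
  · simp [isSelfAdjoint_iff, add_comm]
  · simp [isSelfAdjoint_iff, star_smul, smul_sub, neg_add_eq_sub]

/-- A vector that is separating for `M` is cyclic for the commutant. -/
theorem IsSeparating.isCyclic_commutant {M : VonNeumannAlgebra H} {x : H}
    (hx : IsSeparating M x) : IsCyclic M.commutant x := by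
  let V : Submodule ℂ H := (LinearMap.range (evalAt M.commutant x)).topologicalClosure
  have hV : IsClosed (V : Set H) := Submodule.isClosed_topologicalClosure _
  have : CompleteSpace V := hV.completeSpace_coe
  have hinv : ∀ y ∈ M.commutant, ∀ v ∈ V, y v ∈ V := by
    intro y hy v hv
    refine map_mem_closure y.continuous hv ?_
    rintro _ ⟨b, rfl⟩
    exact ⟨(⟨y, hy⟩ : Alg M.commutant) * b, rfl⟩
  have hP : V.starProjection ∈ M := by
    rw [VonNeumannAlgebra.IsStarProjection.mem_iff isStarProjection_starProjection]
    intro y hy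
    rw [Submodule.range_starProjection]
    exact fun v hv => hinv y hy v hv
  have hxV : x ∈ V := subset_closure ⟨1, rfl⟩
  have h1 : 1 - V.starProjection = 0 := by
    refine hx _ (sub_mem (one_mem M) hP) ?_
    simp [Submodule.starProjection_eq_self_iff.2 hxV]
  intro z
  have hz : z ∈ V := by
    rw [← Submodule.starProjection_eq_self_iff, ← sub_eq_zero.1 h1]
    rfl
  refine closure_mono ?_ hz
  rintro _ ⟨b, rfl⟩
  exact ⟨b, b.2, rfl⟩

end VonNeumann

/-- A `ℤ₂`-graded von Neumann algebra in standard form on `H`, with an even faithful normal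
state. -/
structure GradedVN (H : Type u) [NormedAddCommGroup H] [InnerProductSpace ℂ H]
    [CompleteSpace H] where
  /-- the von Neumann algebra -/
  alg : VonNeumannAlgebra H
  /-- its standard form -/
  std : StandardForm alg
  /-- the grading, an involutive `*`-automorphism -/
  γ : Alg alg →⋆ₐ[ℂ] Alg alg
  γ_γ : ∀ a, γ (γ a) = a
  /-- the state -/
  μ : Alg alg →ₗ[ℂ] ℂ
  faithfulNormal : IsFaithfulNormalState alg μ
  μ_γ : ∀ a, μ (γ a) = μ a

namespace GradedVN

variable {H : Type u} [NormedAddCommGroup H] [InnerProductSpace ℂ H] [CompleteSpace H]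
variable {K : Type v} [NormedAddCommGroup K] [InnerProductSpace ℂ K] [CompleteSpace K]
variable (A : GradedVN H) (B : GradedVN K)

/-- The vector `Λ_μ` in the cone of the standard form that represents the state. -/
def Λ : H := (A.std.existsUnique_vector A.μ A.faithfulNormal.toIsNormalState).choose

theorem Λ_mem : A.Λ ∈ A.std.P :=
  (A.std.existsUnique_vector A.μ A.faithfulNormal.toIsNormalState).choose_spec.1.1

theorem μ_eq (a : Alg A.alg) : A.μ a = ⟪A.Λ, (a : H →L[ℂ] H) A.Λ⟫_ℂ :=
  (A.std.existsUnique_vector A.μ A.faithfulNormal.toIsNormalState).choose_spec.1.2 a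

theorem separating : IsSeparating A.alg A.Λ := by
  intro a ha h
  have := A.faithfulNormal.faithful ⟨a, ha⟩ (by
    rw [A.μ_eq]
    simp [h])
  exact congrArg Subtype.val this

theorem cyclic : IsCyclic A.alg A.Λ :=
  (A.std.cyclic_iff_separating _ A.Λ_mem).2 A.separating

/-- The linear map `a ↦ a Λ_μ`. -/
abbrev evalΛ : Alg A.alg →ₗ[ℂ] H := evalAt A.alg A.Λ

theorem evalΛ_apply (a : Alg A.alg) : A.evalΛ a = (a : H →L[ℂ] H) A.Λ := rfl

theorem denseRange_evalΛ : DenseRange A.evalΛ := A.cyclic.denseRange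

theorem inner_evalΛ (a b : Alg A.alg) : ⟪A.evalΛ a, A.evalΛ b⟫_ℂ = A.μ (star a * b) := by
  rw [A.μ_eq, evalΛ_apply, evalΛ_apply, ← ContinuousLinearMap.adjoint_inner_right]
  rfl

/-- The grading as a linear automorphism. -/
def γEquiv : Alg A.alg ≃ₗ[ℂ] Alg A.alg :=
  LinearEquiv.ofInvolutive A.γ.toAlgHom.toLinearMap A.γ_γ

theorem norm_evalΛ_γ (a : Alg A.alg) : ‖A.evalΛ (A.γEquiv a)‖ = ‖A.evalΛ a‖ := by
  change ‖A.evalΛ (A.γ a)‖ = ‖A.evalΛ a‖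
  rw [@norm_eq_sqrt_re_inner ℂ, @norm_eq_sqrt_re_inner ℂ, inner_evalΛ, inner_evalΛ, ← map_star,
    ← map_mul, A.μ_γ]

/-- The unitary `g` implementing the grading: `g a Λ_μ = γ(a) Λ_μ`. -/
def g : H →L[ℂ] H :=
  ((A.γEquiv.extendOfIsometry A.evalΛ A.evalΛ A.denseRange_evalΛ A.denseRange_evalΛ
    A.norm_evalΛ_γ : H ≃ₗᵢ[ℂ] H) : H →L[ℂ] H)

theorem g_evalΛ (a : Alg A.alg) : A.g (A.evalΛ a) = A.evalΛ (A.γ a) :=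
  LinearEquiv.extendOfIsometry_eq A.γEquiv A.evalΛ A.evalΛ A.denseRange_evalΛ A.denseRange_evalΛ
    A.norm_evalΛ_γ a

theorem g_mul_g : A.g * A.g = 1 := by
  ext x
  refine A.denseRange_evalΛ.induction_on x (isClosed_eq (by fun_prop) (by fun_prop)) fun a => ?_
  simp [g_evalΛ, A.γ_γ]

theorem star_g : star A.g = A.g := by
  have h : star A.g * A.g = 1 := by
    ext x
    refine ext_inner_left ℂ fun y => ?_
    rw [mul_apply_eq_comp, ContinuousLinearMap.star_eq_adjoint,
      ContinuousLinearMap.adjoint_inner_right]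
    exact LinearIsometryEquiv.inner_map_map _ _ _
  calc star A.g = star A.g * (A.g * A.g) := by rw [g_mul_g, mul_one]
    _ = A.g := by rw [← mul_assoc, h, one_mul]

theorem g_Λ : A.g A.Λ = A.Λ := by
  have := A.g_evalΛ 1
  simpa [evalΛ_apply] using this

/-- `g` implements the grading. -/
theorem g_mul_mul_g (a : Alg A.alg) : A.g * a * A.g = A.γ a := by
  ext x
  refine A.denseRange_evalΛ.induction_on x (isClosed_eq (by fun_prop) (by fun_prop)) fun b => ?_
  have h1 : (a : H →L[ℂ] H) (A.evalΛ (A.γ b)) = A.evalΛ (a * A.γ b) := rfl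
  have h2 : (A.γ a : H →L[ℂ] H) (A.evalΛ b) = A.evalΛ (A.γ a * b) := rfl
  simp only [mul_apply_eq_comp, g_evalΛ, h1, h2, map_mul, A.γ_γ]

theorem g_conj_mem_commutant {T : H →L[ℂ] H} (hT : T ∈ A.alg.commutant) :
    A.g * T * A.g ∈ A.alg.commutant := by
  rw [VonNeumannAlgebra.mem_commutant_iff] at hT ⊢
  intro a ha
  have hγ := A.g_mul_mul_g (A.γ ⟨a, ha⟩)
  rw [A.γ_γ] at hγ
  have h := hT _ (A.γ ⟨a, ha⟩).2
  change A.g * _ * A.g = a at hγ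
  rw [← hγ]
  have hg := A.g_mul_g
  generalize (A.γ ⟨a, ha⟩ : H →L[ℂ] H) = c at *
  calc A.g * c * A.g * (A.g * T * A.g) = A.g * c * (A.g * A.g) * T * A.g := by
        simp only [mul_assoc]
    _ = A.g * (c * T) * A.g := by rw [hg]; simp only [mul_assoc, mul_one]
    _ = A.g * T * (A.g * A.g) * c * A.g := by rw [h, hg]; simp only [mul_assoc, mul_one]
    _ = _ := by simp only [mul_assoc]

/-- The projection `p⁺ = (1 + g) / 2`. -/
def pPlus : H →L[ℂ] H := (2⁻¹ : ℂ) • (1 + A.g)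

/-- The projection `p⁻ = (1 - g) / 2`. -/
def pMinus : H →L[ℂ] H := (2⁻¹ : ℂ) • (1 - A.g)

/-- The unitary operator `g^(1/2) = p⁺ - i p⁻`. -/
def gHalf : H →L[ℂ] H := A.pPlus - Complex.I • A.pMinus

theorem star_gHalf : star A.gHalf = A.pPlus + Complex.I • A.pMinus := by
  simp [gHalf, pPlus, pMinus, star_g, star_smul, sub_eq_add_neg, add_comm]

theorem pPlus_add_pMinus : A.pPlus + A.pMinus = 1 := by
  rw [pPlus, pMinus, ← smul_add, add_add_sub_cancel, ← two_smul ℂ (1 : H →L[ℂ] H), smul_smul]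
  norm_num

theorem pPlus_mul_pMinus : A.pPlus * A.pMinus = 0 := by
  rw [pPlus, pMinus, smul_mul_smul_comm, add_mul, mul_sub, mul_sub, g_mul_g]
  simp

theorem pMinus_mul_pPlus : A.pMinus * A.pPlus = 0 := by
  rw [pPlus, pMinus, smul_mul_smul_comm, sub_mul, mul_add, mul_add, g_mul_g]
  simp [add_comm]

theorem gHalf_mem_unitary : A.gHalf ∈ unitary (H →L[ℂ] H) := by
  have hp : A.pPlus * A.pPlus = A.pPlus := by
    have := congrArg (A.pPlus * ·) A.pPlus_add_pMinus
    simpa [mul_add, pPlus_mul_pMinus] using this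
  have hm : A.pMinus * A.pMinus = A.pMinus := by
    have := congrArg (A.pMinus * ·) A.pPlus_add_pMinus
    simpa [mul_add, pMinus_mul_pPlus] using this
  rw [Unitary.mem_iff, star_gHalf, gHalf]
  constructor <;>
  · have hI : ∀ x : H →L[ℂ] H, Complex.I • Complex.I • x = -x := fun x => by
      rw [smul_smul, Complex.I_mul_I, neg_one_smul]
    simp only [add_mul, mul_sub, sub_mul, mul_add, mul_smul_comm,
      smul_mul_assoc, hp, hm, pPlus_mul_pMinus, pMinus_mul_pPlus, smul_zero]
    rw [← A.pPlus_add_pMinus]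
    simp
    erw [hI]
    simp

/-- `g^(1/2)` as an element of the unitary group. -/
def gHalfU : unitary (H →L[ℂ] H) := ⟨A.gHalf, A.gHalf_mem_unitary⟩

/-- The Klein isomorphism `T ↦ g^(1/2) T g^(-1/2)`. -/
def klein : (H →L[ℂ] H) →⋆ₐ[ℂ] (H →L[ℂ] H) :=
  StarAlgHomClass.toStarAlgHom (Unitary.conjStarAlgAut ℂ (H →L[ℂ] H) A.gHalfU)

theorem klein_apply (T : H →L[ℂ] H) : A.klein T = A.gHalf * T * star A.gHalf := rfl

/-- The twisted commutant `g^(1/2) A' g^(-1/2)`. -/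
def twisted : StarSubalgebra ℂ (H →L[ℂ] H) :=
  A.alg.commutant.toStarSubalgebra.map A.klein

theorem mem_twisted {T : H →L[ℂ] H} :
    T ∈ A.twisted ↔ ∃ S ∈ A.alg.commutant, A.klein S = T := Iff.rfl

theorem klein_mem_twisted {T : H →L[ℂ] H} (hT : T ∈ A.alg.commutant) : A.klein T ∈ A.twisted :=
  ⟨T, hT, rfl⟩

theorem gHalf_mul_g : A.gHalf * A.g = A.g * A.gHalf := by
  simp [gHalf, pPlus, pMinus, mul_add, add_mul, mul_sub, sub_mul, g_mul_g]

theorem star_gHalf_mul_g : star A.gHalf * A.g = A.g * star A.gHalf := by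
  simp [star_gHalf, pPlus, pMinus, mul_add, add_mul, mul_sub, sub_mul, g_mul_g]

theorem g_mul_klein_mul_g (T : H →L[ℂ] H) : A.g * A.klein T * A.g = A.klein (A.g * T * A.g) := by
  rw [klein_apply, klein_apply]
  calc A.g * (A.gHalf * T * star A.gHalf) * A.g
      = (A.g * A.gHalf) * T * (star A.gHalf * A.g) := by simp only [mul_assoc]
    _ = _ := by rw [← gHalf_mul_g, star_gHalf_mul_g]; simp only [mul_assoc]

/-- The grading `b ↦ g b g` of the twisted commutant. -/
def γTwisted : A.twisted →⋆ₐ[ℂ] A.twisted where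
  toFun b := ⟨A.g * b * A.g, by
    obtain ⟨T, hT, h⟩ := A.mem_twisted.1 b.2
    rw [← h, g_mul_klein_mul_g]
    exact A.klein_mem_twisted (A.g_conj_mem_commutant hT)⟩
  map_one' := by ext1; simp [g_mul_g]
  map_mul' a b := by
    ext1
    change A.g * ((a : H →L[ℂ] H) * b) * A.g = A.g * a * A.g * (A.g * b * A.g)
    calc A.g * ((a : H →L[ℂ] H) * b) * A.g = A.g * a * 1 * b * A.g := by
          simp only [mul_assoc, one_mul]
      _ = _ := by rw [← A.g_mul_g]; simp only [mul_assoc]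
  map_zero' := by ext1; simp
  map_add' a b := by ext1; simp [mul_add, add_mul]
  commutes' r := by
    ext1
    simp [Algebra.algebraMap_eq_smul_one, g_mul_g]
  map_star' a := by
    ext1
    simp [star_mul, star_g, mul_assoc]

theorem γTwisted_coe (b : A.twisted) : (A.γTwisted b : H →L[ℂ] H) = A.g * b * A.g := rfl

theorem star_gHalf_mul_gHalf : star A.gHalf * A.gHalf = 1 :=
  (Unitary.mem_iff.1 A.gHalf_mem_unitary).1

theorem gHalf_mul_star_gHalf : A.gHalf * star A.gHalf = 1 :=
  (Unitary.mem_iff.1 A.gHalf_mem_unitary).2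

theorem gHalf_apply (x : H) :
    A.gHalf x = (2⁻¹ : ℂ) • (x + A.g x) - Complex.I • (2⁻¹ : ℂ) • (x - A.g x) := by
  simp [gHalf, pPlus, pMinus]

theorem star_gHalf_apply (x : H) :
    star A.gHalf x = (2⁻¹ : ℂ) • (x + A.g x) + Complex.I • (2⁻¹ : ℂ) • (x - A.g x) := by
  simp [star_gHalf, pPlus, pMinus]

theorem gHalf_Λ : A.gHalf A.Λ = A.Λ := by
  rw [gHalf_apply, g_Λ, sub_self, smul_zero, smul_zero, sub_zero, ← two_smul ℂ A.Λ, smul_smul]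
  norm_num

theorem star_gHalf_Λ : star A.gHalf A.Λ = A.Λ := by
  rw [star_gHalf_apply, g_Λ, sub_self, smul_zero, smul_zero, add_zero, ← two_smul ℂ A.Λ, smul_smul]
  norm_num

theorem klein_apply_Λ (T : H →L[ℂ] H) : A.klein T A.Λ = A.gHalf (T A.Λ) := by
  rw [klein_apply, mul_apply_eq_comp, mul_apply_eq_comp, star_gHalf_Λ]

theorem isPositive_klein {T : H →L[ℂ] H} (hT : T.IsPositive) : (A.klein T).IsPositive := by
  simpa [klein_apply, mul_assoc, ContinuousLinearMap.star_eq_adjoint, ContinuousLinearMap.mul_def,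
    ContinuousLinearMap.comp_assoc] using hT.conj_adjoint A.gHalf

theorem isPositive_of_klein {T : H →L[ℂ] H} (hT : (A.klein T).IsPositive) : T.IsPositive := by
  have h := hT.adjoint_conj A.gHalf
  have e : (star A.gHalf) * A.klein T * A.gHalf = T := by
    rw [klein_apply]
    calc star A.gHalf * (A.gHalf * T * star A.gHalf) * A.gHalf
        = (star A.gHalf * A.gHalf) * T * (star A.gHalf * A.gHalf) := by simp only [mul_assoc]
      _ = T := by rw [star_gHalf_mul_gHalf, one_mul, mul_one]
  rw [← e]
  simpa [mul_assoc, ContinuousLinearMap.star_eq_adjoint, ContinuousLinearMap.mul_def,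
    ContinuousLinearMap.comp_assoc] using h

/-- `Λ_μ` is separating for the twisted commutant. -/
theorem eq_of_inner_twisted {b c : A.twisted}
    (h : ∀ a : Alg A.alg, ⟪A.Λ, (a : H →L[ℂ] H) ((b : H →L[ℂ] H) A.Λ)⟫_ℂ =
      ⟪A.Λ, (a : H →L[ℂ] H) ((c : H →L[ℂ] H) A.Λ)⟫_ℂ) : b = c := by
  obtain ⟨S, hS, hb⟩ := A.mem_twisted.1 b.2
  obtain ⟨T, hT, hc⟩ := A.mem_twisted.1 c.2
  have h1 : (b : H →L[ℂ] H) A.Λ = (c : H →L[ℂ] H) A.Λ := by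
    refine ext_inner_left ℂ fun z => ?_
    refine A.denseRange_evalΛ.induction_on z (isClosed_eq (by fun_prop) (by fun_prop)) fun a => ?_
    have := h (star a)
    change ⟪A.Λ, ContinuousLinearMap.adjoint (a : H →L[ℂ] H) _⟫_ℂ =
      ⟪A.Λ, ContinuousLinearMap.adjoint (a : H →L[ℂ] H) _⟫_ℂ at this
    rwa [ContinuousLinearMap.adjoint_inner_right, ContinuousLinearMap.adjoint_inner_right] at this
  rw [← hb, ← hc, klein_apply_Λ, klein_apply_Λ] at h1
  have h2 : S A.Λ = T A.Λ := by
    have := congrArg (fun y => (star A.gHalf : H →L[ℂ] H) y) h1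
    rwa [← mul_apply_eq_comp, ← mul_apply_eq_comp (star A.gHalf) A.gHalf, star_gHalf_mul_gHalf]
      at this
  have h3 : S = T := by
    ext z
    refine A.denseRange_evalΛ.induction_on z (isClosed_eq (by fun_prop) (by fun_prop)) fun a => ?_
    have hS' := VonNeumannAlgebra.mem_commutant_iff.1 hS _ a.2
    have hT' := VonNeumannAlgebra.mem_commutant_iff.1 hT _ a.2
    rw [evalΛ_apply, ← mul_apply_eq_comp, ← mul_apply_eq_comp, ← hS', ← hT', mul_apply_eq_comp,
      mul_apply_eq_comp, h2]
  exact Subtype.ext (by rw [← hb, ← hc, h3])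

theorem inner_apply_g (a : Alg A.alg) (x : H) :
    ⟪A.Λ, (a : H →L[ℂ] H) (A.g x)⟫_ℂ = ⟪A.Λ, (A.γ a : H →L[ℂ] H) x⟫_ℂ := by
  rw [← g_mul_mul_g, mul_apply_eq_comp, mul_apply_eq_comp,
    ← ContinuousLinearMap.adjoint_inner_left A.g, ← ContinuousLinearMap.star_eq_adjoint, star_g,
    g_Λ]

theorem inner_apply_gHalf (a : Alg A.alg) (x : H) :
    ⟪A.Λ, (a : H →L[ℂ] H) (A.gHalf x)⟫_ℂ =
      ⟪A.Λ, ((evenPart A.γ a - Complex.I • oddPart A.γ a : Alg A.alg) : H →L[ℂ] H) x⟫_ℂ := by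
  rw [gHalf_apply, evenPart_apply, oddPart_apply]
  simp only [map_sub, map_add, map_smul, inner_sub_right, inner_add_right, inner_smul_right,
    inner_apply_g]
  simp [inner_add_right, inner_sub_right, inner_smul_right, mul_add, mul_sub]

end GradedVN

section Duals

variable {H : Type u} [NormedAddCommGroup H] [InnerProductSpace ℂ H] [CompleteSpace H]
variable {K : Type v} [NormedAddCommGroup K] [InnerProductSpace ℂ K] [CompleteSpace K]

/-- An even unital positive map `E : A → B` with `ν ∘ E = μ`. -/
structure EvenUP (A : GradedVN H) (B : GradedVN K) where
  /-- the underlying linear map -/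
  map : Alg A.alg →ₗ[ℂ] Alg B.alg
  map_one : map 1 = 1
  map_pos : ∀ a : Alg A.alg, (a : H →L[ℂ] H).IsPositive → (map a : K →L[ℂ] K).IsPositive
  even : ∀ a, map (A.γ a) = B.γ (map a)
  state : ∀ a, B.μ (map a) = A.μ a

variable {A : GradedVN H} {B : GradedVN K}

/-- `D : B^≀ → A^≀` is a twisted dual of `E`. -/
structure IsTwistedDual (E : EvenUP A B) (D : B.twisted →ₗ[ℂ] A.twisted) : Prop where
  map_pos : ∀ b : B.twisted, (b : K →L[ℂ] K).IsPositive → (D b : H →L[ℂ] H).IsPositive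
  inner_eq : ∀ (a : Alg A.alg) (b : B.twisted),
    ⟪A.Λ, (a : H →L[ℂ] H) ((D b : H →L[ℂ] H) A.Λ)⟫_ℂ =
      ⟪B.Λ, (E.map a : K →L[ℂ] K) ((b : K →L[ℂ] K) B.Λ)⟫_ℂ

theorem isPositive_star_mul_self {M : VonNeumannAlgebra H} (a : Alg M) :
    ((star a * a : Alg M) : H →L[ℂ] H).IsPositive := by
  rw [← ContinuousLinearMap.nonneg_iff_isPositive]
  exact star_mul_self_nonneg (a : H →L[ℂ] H)

theorem EvenUP.exists_dual_pos (E : EvenUP A B) {b : K →L[ℂ] K} (hb : b ∈ B.alg.commutant)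
    (hpos : b.IsPositive) :
    ∃ T ∈ A.alg.commutant, T.IsPositive ∧ ∀ a : Alg A.alg,
      ⟪B.Λ, (E.map a : K →L[ℂ] K) (b B.Λ)⟫_ℂ = ⟪A.Λ, (a : H →L[ℂ] H) (T A.Λ)⟫_ℂ := by
  let φ : Alg A.alg →ₗ[ℂ] ℂ :=
    { toFun := fun a => ⟪B.Λ, (E.map a : K →L[ℂ] K) (b B.Λ)⟫_ℂ
      map_add' := fun x y => by simp [inner_add_right]
      map_smul' := fun r x => by simp [inner_smul_right] }
  have key : ∀ (c : K →L[ℂ] K), c ∈ B.alg.commutant → c.IsPositive → ∀ a : Alg A.alg,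
      0 ≤ ⟪B.Λ, (E.map (star a * a) : K →L[ℂ] K) (c B.Λ)⟫_ℂ := fun c hc hcp a =>
    inner_mul_nonneg (E.map_pos _ (isPositive_star_mul_self a)) hcp
      (VonNeumannAlgebra.mem_commutant_iff.1 hc _ (E.map (star a * a)).2) _
  refine exists_commutant_of_dominated A.cyclic φ ‖b‖ (key b hb hpos) fun a => ?_
  have h := key _ (sub_mem (B.alg.commutant.toStarSubalgebra.smul_mem
    (one_mem B.alg.commutant) (‖b‖ : ℂ)) hb) (norm_smul_one_sub_isPositive hpos.isSelfAdjoint) a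
  have h1 : ⟪B.Λ, (E.map (star a * a) : K →L[ℂ] K) B.Λ⟫_ℂ = (‖A.evalΛ a‖ ^ 2 : ℝ) := by
    rw [← B.μ_eq, E.state, ← A.inner_evalΛ, inner_self_eq_norm_sq_to_K]
    norm_cast
  have h2 := (Complex.le_def.1 h).1
  have h3 : ⟪B.Λ, (E.map (star a * a) : K →L[ℂ] K)
      ((((‖b‖ : ℂ) • (1 : K →L[ℂ] K) - b : K →L[ℂ] K)) B.Λ)⟫_ℂ =
      (‖b‖ : ℂ) * (‖A.evalΛ a‖ ^ 2 : ℝ) - φ (star a * a) := by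
    rw [← h1]
    simp [φ, inner_sub_right, inner_smul_right]
  rw [h3] at h2
  rw [← Complex.ofReal_mul, Complex.sub_re, Complex.ofReal_re, Complex.zero_re] at h2
  linarith

theorem EvenUP.exists_dual (E : EvenUP A B) {b : K →L[ℂ] K} (hb : b ∈ B.alg.commutant) :
    ∃ T ∈ A.alg.commutant, ∀ a : Alg A.alg,
      ⟪B.Λ, (E.map a : K →L[ℂ] K) (b B.Λ)⟫_ℂ = ⟪A.Λ, (a : H →L[ℂ] H) (T A.Λ)⟫_ℂ := by
  refine induction_isPositive B.alg.commutant
    (fun b => ∃ T ∈ A.alg.commutant, ∀ a : Alg A.alg,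
      ⟪B.Λ, (E.map a : K →L[ℂ] K) (b B.Λ)⟫_ℂ = ⟪A.Λ, (a : H →L[ℂ] H) (T A.Λ)⟫_ℂ) ?_ ?_ ?_ hb
  · intro b hb hp
    obtain ⟨T, hT, -, h⟩ := E.exists_dual_pos hb hp
    exact ⟨T, hT, h⟩
  · rintro b - c - ⟨S, hS, h⟩ ⟨T, hT, h'⟩
    refine ⟨S + T, add_mem hS hT, fun a => ?_⟩
    simp [inner_add_right, h, h']
  · rintro r b - ⟨S, hS, h⟩
    refine ⟨r • S, A.alg.commutant.toStarSubalgebra.smul_mem hS r, fun a => ?_⟩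
    simp [inner_smul_right, h]

theorem EvenUP.inner_klein (E : EvenUP A B) {b : K →L[ℂ] K} {T : H →L[ℂ] H}
    (h : ∀ a : Alg A.alg,
      ⟪B.Λ, (E.map a : K →L[ℂ] K) (b B.Λ)⟫_ℂ = ⟪A.Λ, (a : H →L[ℂ] H) (T A.Λ)⟫_ℂ)
    (a : Alg A.alg) :
    ⟪A.Λ, (a : H →L[ℂ] H) (A.klein T A.Λ)⟫_ℂ =
      ⟪B.Λ, (E.map a : K →L[ℂ] K) (B.klein b B.Λ)⟫_ℂ := by
  rw [A.klein_apply_Λ, B.klein_apply_Λ, A.inner_apply_gHalf, B.inner_apply_gHalf, ← h]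
  simp only [evenPart_apply, oddPart_apply, map_sub, map_add, map_smul, E.even]

theorem EvenUP.exists_twistedDual (E : EvenUP A B) : ∃ D, IsTwistedDual E D := by
  have h : ∀ b : B.twisted, ∃ c : A.twisted, ∀ a : Alg A.alg,
      ⟪A.Λ, (a : H →L[ℂ] H) ((c : H →L[ℂ] H) A.Λ)⟫_ℂ =
      ⟪B.Λ, (E.map a : K →L[ℂ] K) ((b : K →L[ℂ] K) B.Λ)⟫_ℂ := by
    intro b
    obtain ⟨S, hS, hb⟩ := B.mem_twisted.1 b.2
    obtain ⟨T, hT, h⟩ := E.exists_dual hS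
    exact ⟨⟨A.klein T, A.klein_mem_twisted hT⟩, fun a => by rw [← hb]; exact E.inner_klein h a⟩
  choose d hd using h
  refine ⟨{ toFun := d, map_add' := fun x y => ?_, map_smul' := fun r x => ?_ }, fun b hb => ?_,
    fun a b => hd b a⟩
  · refine A.eq_of_inner_twisted fun a => ?_
    simp [inner_add_right, hd]
  · refine A.eq_of_inner_twisted fun a => ?_
    simp [inner_smul_right, hd]
  · obtain ⟨S, hS, hbS⟩ := B.mem_twisted.1 b.2
    obtain ⟨T, hT, hTp, h⟩ := E.exists_dual_pos hS (B.isPositive_of_klein (hbS ▸ hb))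
    have : d b = ⟨A.klein T, A.klein_mem_twisted hT⟩ :=
      A.eq_of_inner_twisted fun a => by rw [hd, ← hbS]; exact (E.inner_klein h a).symm
    change ((d b : A.twisted) : H →L[ℂ] H).IsPositive
    rw [this]
    exact A.isPositive_klein hTp

theorem IsTwistedDual.unique {E : EvenUP A B} {D D' : B.twisted →ₗ[ℂ] A.twisted}
    (h : IsTwistedDual E D) (h' : IsTwistedDual E D') : D = D' :=
  LinearMap.ext fun b => A.eq_of_inner_twisted fun a => by rw [h.inner_eq, h'.inner_eq]

/-- The twisted dual `E^≀ : B^≀ → A^≀`. -/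
def EvenUP.twistedDual (E : EvenUP A B) : B.twisted →ₗ[ℂ] A.twisted :=
  E.exists_twistedDual.choose

theorem EvenUP.isTwistedDual (E : EvenUP A B) : IsTwistedDual E E.twistedDual :=
  E.exists_twistedDual.choose_spec

/-- The grading as an even unital positive map. -/
def GradedVN.gradingUP (A : GradedVN H) : EvenUP A A where
  map := A.γ.toAlgHom.toLinearMap
  map_one := _root_.map_one A.γ
  map_pos a ha := by
    change (A.γ a : H →L[ℂ] H).IsPositive
    rw [← A.g_mul_mul_g]
    have := ha.conj_adjoint A.g
    rwa [← ContinuousLinearMap.star_eq_adjoint, A.star_g] at this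
  even _ := rfl
  state := A.μ_γ

theorem GradedVN.twistedDual_gradingUP (A : GradedVN H) (b : A.twisted) :
    A.gradingUP.twistedDual b = A.γTwisted b := by
  refine A.eq_of_inner_twisted fun a => ?_
  rw [A.gradingUP.isTwistedDual.inner_eq, A.γTwisted_coe, mul_apply_eq_comp, mul_apply_eq_comp,
    A.g_Λ, A.inner_apply_g]
  rfl

end Duals

section Plans

variable {H : Type u} [NormedAddCommGroup H] [InnerProductSpace ℂ H] [CompleteSpace H]
variable {K : Type v} [NormedAddCommGroup K] [InnerProductSpace ℂ K] [CompleteSpace K]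

/-- The state `μ^≀(b) = ⟨Λ_μ, b Λ_μ⟩` on the twisted commutant. -/
def GradedVN.μTwisted (A : GradedVN H) : A.twisted →ₗ[ℂ] ℂ where
  toFun b := ⟪A.Λ, (b : H →L[ℂ] H) A.Λ⟫_ℂ
  map_add' x y := by simp [inner_add_right]
  map_smul' r x := by simp [inner_smul_right]

/-- `ω` is a fermionic transport plan from the state of `A` to the state of `B`. -/
structure IsFermiPlan (A : GradedVN H) (B : GradedVN K)
    (ω : Alg A.alg ⊗[ℂ] B.twisted →ₗ[ℂ] ℂ) : Prop extends IsFermiState A.γ B.γTwisted ω where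
  left : ∀ a, ω (a ⊗ₜ 1) = A.μ a
  right : ∀ b, ω (1 ⊗ₜ b) = B.μTwisted b
  balance : ∀ a b, ω (A.γ a ⊗ₜ b) = ω (a ⊗ₜ B.gradingUP.twistedDual b)

variable {A : GradedVN H} {B : GradedVN K}

/-! The rest of this section shows that every plan is represented by a unique map `A → B`. -/

section Parts

variable {R : Type u} [Ring R] [StarRing R] [Algebra ℂ R] [StarModule ℂ R] {γ : R →⋆ₐ[ℂ] R}

theorem map_evenPart (hγ : ∀ a, γ (γ a) = a) (a : R) : γ (evenPart γ a) = evenPart γ a := by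
  simp [evenPart_apply, hγ, add_comm]

theorem map_oddPart (hγ : ∀ a, γ (γ a) = a) (a : R) : γ (oddPart γ a) = -oddPart γ a := by
  rw [oddPart_apply, map_smul, map_sub, hγ, ← smul_neg, neg_sub]

theorem evenPart_of_even {a : R} (h : γ a = a) : evenPart γ a = a := by
  rw [evenPart_apply, h]; module

theorem oddPart_of_even {a : R} (h : γ a = a) : oddPart γ a = 0 := by
  rw [oddPart_apply, h]; module

theorem evenPart_of_odd {a : R} (h : γ a = -a) : evenPart γ a = 0 := by
  rw [evenPart_apply, h]; module

theorem oddPart_of_odd {a : R} (h : γ a = -a) : oddPart γ a = a := by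
  rw [oddPart_apply, h]; module

theorem evenPart_add_oddPart (a : R) : evenPart γ a + oddPart γ a = a := by
  rw [evenPart_apply, oddPart_apply]; module

theorem evenPart_sub_oddPart (a : R) : evenPart γ a - oddPart γ a = γ a := by
  rw [evenPart_apply, oddPart_apply]; module

theorem evenPart_add {e o : R} (he : γ e = e) (ho : γ o = -o) : evenPart γ (e + o) = e := by
  rw [map_add, evenPart_of_even he, evenPart_of_odd ho, add_zero]

theorem oddPart_add {e o : R} (he : γ e = e) (ho : γ o = -o) : oddPart γ (e + o) = o := by
  rw [map_add, oddPart_of_even he, oddPart_of_odd ho, zero_add]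

theorem parts_untwist (hγ : ∀ a, γ (γ a) = a) (b : R) :
    evenPart γ (evenPart γ b - Complex.I • oddPart γ b) +
      Complex.I • oddPart γ (evenPart γ b - Complex.I • oddPart γ b) = b := by
  have h1 := map_evenPart hγ b
  have h2 := map_oddPart hγ b
  rw [map_sub, map_sub, map_smul, map_smul, evenPart_of_even h1, oddPart_of_even h1,
    evenPart_of_odd h2, oddPart_of_odd h2, smul_zero, sub_zero, zero_sub, smul_neg, smul_smul,
    Complex.I_mul_I, neg_one_smul, neg_neg, evenPart_add_oddPart]

end Parts

theorem GradedVN.γTwisted_γTwisted (A : GradedVN H) (b : A.twisted) :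
    A.γTwisted (A.γTwisted b) = b := by
  ext1
  rw [γTwisted_coe, γTwisted_coe]
  calc A.g * (A.g * (b : H →L[ℂ] H) * A.g) * A.g = (A.g * A.g) * b * (A.g * A.g) := by
        simp only [mul_assoc]
    _ = b := by rw [g_mul_g, one_mul, mul_one]

theorem IsFermiPlan.map_γ {ω : Alg A.alg ⊗[ℂ] B.twisted →ₗ[ℂ] ℂ} (hω : IsFermiPlan A B ω)
    (a : Alg A.alg) (b : B.twisted) : ω (A.γ a ⊗ₜ b) = ω (a ⊗ₜ B.γTwisted b) := by
  rw [hω.balance, B.twistedDual_gradingUP]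

section Untwist

variable {R : Type u} [Ring R] [StarRing R] [Algebra ℂ R] [StarModule ℂ R] {γA : R →⋆ₐ[ℂ] R}
variable {S : Type v} [Ring S] [StarRing S] [Algebra ℂ S] [StarModule ℂ S] {γB : S →⋆ₐ[ℂ] S}

theorem evenPart_tmul_of_balance {ω : R ⊗[ℂ] S →ₗ[ℂ] ℂ}
    (hω : ∀ a b, ω (γA a ⊗ₜ b) = ω (a ⊗ₜ γB b)) (a : R) {b : S} (hb : γB b = b) :
    ω (evenPart γA a ⊗ₜ b) = ω (a ⊗ₜ b) := by
  have := hω a b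
  rw [evenPart_apply, ← TensorProduct.smul_tmul', map_smul, TensorProduct.add_tmul, map_add, this,
    hb, smul_eq_mul]
  ring

theorem oddPart_tmul_of_balance {ω : R ⊗[ℂ] S →ₗ[ℂ] ℂ}
    (hω : ∀ a b, ω (γA a ⊗ₜ b) = ω (a ⊗ₜ γB b)) (a : R) {b : S} (hb : γB b = -b) :
    ω (oddPart γA a ⊗ₜ b) = ω (a ⊗ₜ b) := by
  have := hω a b
  rw [oddPart_apply, ← TensorProduct.smul_tmul', map_smul, TensorProduct.sub_tmul, map_sub, this,
    hb, TensorProduct.tmul_neg, map_neg, smul_eq_mul]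
  ring

/-- Simple tensors of positive elements are, after untwisting the second factor, positive
for `ω`. -/
theorem IsFermiState.untwisted_nonneg {ω : R ⊗[ℂ] S →ₗ[ℂ] ℂ} (hω : IsFermiState γA γB ω)
    (hA : ∀ a, γA (γA a) = a) (hB : ∀ b, γB (γB b) = b)
    (hbal : ∀ a b, ω (γA a ⊗ₜ b) = ω (a ⊗ₜ γB b)) (c : R) (d : S) :
    0 ≤ ω ((star c * c) ⊗ₜ (evenPart γB (star d * d) +
      Complex.I • oddPart γB (star d * d))) := by
  set d0 := evenPart γB d with hd0
  set d1 := oddPart γB d with hd1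
  set c0 := evenPart γA c with hc0
  set c1 := oddPart γA c with hc1
  have h0 : γB d0 = d0 := map_evenPart hB d
  have h1 : γB d1 = -d1 := map_oddPart hB d
  have k0 : γA c0 = c0 := map_evenPart hA c
  have k1 : γA c1 = -c1 := map_oddPart hA c
  have hs0 : γB (star d0) = star d0 := by rw [map_star, h0]
  have hs1 : γB (star d1) = -star d1 := by rw [map_star, h1, star_neg]
  set x := c0 - Complex.I • c1 with hx
  have hγx : γA x = c0 + Complex.I • c1 := by
    rw [hx, map_sub, map_smul, k0, k1, smul_neg, sub_neg_eq_add]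
  have hsx : star x = star c0 + Complex.I • star c1 := by
    simp [hx, star_sub, star_smul]
  have hu := hω.nonneg (x ⊗ₜ d0 + γA x ⊗ₜ d1)
  have hstar : fermiStar γA γB (x ⊗ₜ d0 + γA x ⊗ₜ d1) =
      star x ⊗ₜ star d0 + star x ⊗ₜ star d1 := by
    rw [fermiStar_add, fermiStar_tmul, fermiStar_tmul, evenPart_of_even h0, oddPart_of_even h0,
      evenPart_of_odd h1, oddPart_of_odd h1, hA]
    simp
  have hmul : fermiMul γA γB (star x ⊗ₜ star d0 + star x ⊗ₜ star d1) (x ⊗ₜ d0 + γA x ⊗ₜ d1) =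
      (star x * x) ⊗ₜ[ℂ] (star d0 * d0 + star d1 * d1) +
        (star x * γA x) ⊗ₜ[ℂ] (star d0 * d1 + star d1 * d0) := by
    simp only [map_add, LinearMap.add_apply, fermiMul_tmul, evenPart_of_even hs0,
      oddPart_of_even hs0, evenPart_of_odd hs1, oddPart_of_odd hs1, hA, zero_mul,
      TensorProduct.tmul_zero, add_zero, zero_add, TensorProduct.tmul_add]
    abel
  have hdd : star d * d = (star d0 * d0 + star d1 * d1) + (star d0 * d1 + star d1 * d0) := by
    conv_lhs => rw [← evenPart_add_oddPart (γ := γB) d]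
    rw [star_add, add_mul, mul_add, mul_add]
    abel
  have he : γB (star d0 * d0 + star d1 * d1) = star d0 * d0 + star d1 * d1 := by
    simp [h0, h1, map_star]
  have ho : γB (star d0 * d1 + star d1 * d0) = -(star d0 * d1 + star d1 * d0) := by
    simp [h0, h1, map_star, add_comm]
  have hcc : star c * c = (star c0 * c0 + star c1 * c1) + (star c0 * c1 + star c1 * c0) := by
    conv_lhs => rw [← evenPart_add_oddPart (γ := γA) c]
    rw [star_add, add_mul, mul_add, mul_add]
    abel
  have hce : γA (star c0 * c0 + star c1 * c1) = star c0 * c0 + star c1 * c1 := by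
    simp [k0, k1, map_star]
  have hco : γA (star c0 * c1 + star c1 * c0) = -(star c0 * c1 + star c1 * c0) := by
    simp [k0, k1, map_star, add_comm]
  have hco' : γA (star c1 * c0 - star c0 * c1) = -(star c1 * c0 - star c0 * c1) := by
    simp [k0, k1, map_star]; abel
  have hxx : star x * x = (star c0 * c0 + star c1 * c1) +
      Complex.I • (star c1 * c0 - star c0 * c1) := by
    rw [hsx, hx]
    simp only [add_mul, mul_sub, smul_mul_assoc, mul_smul_comm, smul_smul, Complex.I_mul_I]
    match_scalars <;> ring_nf <;> simp
  have hce' : γA (star c0 * c0 - star c1 * c1) = star c0 * c0 - star c1 * c1 := by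
    simp [k0, k1, map_star]
  have hxg : star x * γA x = (star c0 * c0 - star c1 * c1) +
      Complex.I • (star c0 * c1 + star c1 * c0) := by
    rw [hsx, hγx]
    simp only [add_mul, mul_add, smul_mul_assoc, mul_smul_comm, smul_smul, Complex.I_mul_I]
    match_scalars <;> ring_nf <;> simp
  rw [hstar, hmul, map_add, ← evenPart_tmul_of_balance hbal _ he, ← oddPart_tmul_of_balance hbal _ ho] at hu
  rw [hdd, evenPart_add he ho, oddPart_add he ho, TensorProduct.tmul_add, TensorProduct.tmul_smul,
    map_add, map_smul, ← evenPart_tmul_of_balance hbal _ he, ← oddPart_tmul_of_balance hbal _ ho]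
  have hI : γA (Complex.I • (star c1 * c0 - star c0 * c1)) =
      -(Complex.I • (star c1 * c0 - star c0 * c1)) := by rw [map_smul, hco', smul_neg]
  have hI' : γA (Complex.I • (star c0 * c1 + star c1 * c0)) =
      -(Complex.I • (star c0 * c1 + star c1 * c0)) := by rw [map_smul, hco, smul_neg]
  rw [hxx, hxg, evenPart_add hce hI, oddPart_add hce' hI', ← TensorProduct.smul_tmul',
    map_smul] at hu
  rw [hcc, evenPart_add hce hco, oddPart_add hce hco]
  exact hu

end Untwist

theorem exists_star_mul_self {M : VonNeumannAlgebra H} {a : H →L[ℂ] H} (ha : a ∈ M)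
    (hp : a.IsPositive) : ∃ c ∈ M, star c * c = a := by
  rw [← ContinuousLinearMap.nonneg_iff_isPositive] at hp
  refine ⟨CFC.sqrt a, ?_, ?_⟩
  · rw [← VonNeumannAlgebra.commutant_commutant M, VonNeumannAlgebra.mem_commutant_iff]
    intro y hy
    have hc : Commute a y := VonNeumannAlgebra.mem_commutant_iff.1 hy a ha
    exact (hc.cfcₙ_nnreal NNReal.sqrt).symm
  · rw [(CFC.sqrt_nonneg a).isSelfAdjoint.star_eq, CFC.sqrt_mul_sqrt_self a hp]

/-- The Klein isomorphism from the commutant to the twisted commutant, as a linear map. -/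
def GradedVN.kleinL (A : GradedVN H) : Alg A.alg.commutant →ₗ[ℂ] A.twisted where
  toFun b := ⟨A.klein b, A.klein_mem_twisted b.2⟩
  map_add' x y := by ext1; simp
  map_smul' r x := by ext1; simp

theorem GradedVN.kleinL_star_mul (A : GradedVN H) (b : Alg A.alg.commutant) :
    A.kleinL (star b * b) = star (A.kleinL b) * A.kleinL b := by
  ext1
  change A.klein (star (b : H →L[ℂ] H) * b) = star (A.klein b) * A.klein b
  rw [map_mul, map_star]

theorem GradedVN.exists_untwist (B : GradedVN K) (b : B.twisted) :
    ∃ S : Alg B.alg.commutant, evenPart B.γTwisted (B.kleinL S) +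
      Complex.I • oddPart B.γTwisted (B.kleinL S) = b ∧
      (S : K →L[ℂ] K) B.Λ = (b : K →L[ℂ] K) B.Λ := by
  obtain ⟨S, hS, hb⟩ := B.mem_twisted.1 b.2
  let S1 : Alg B.alg.commutant := ⟨S, hS⟩
  let S2 : Alg B.alg.commutant := ⟨B.g * S * B.g, B.g_conj_mem_commutant hS⟩
  have hk1 : B.kleinL S1 = b := Subtype.ext hb
  have hk2 : B.kleinL S2 = B.γTwisted b := by
    ext1
    rw [B.γTwisted_coe, ← hb, B.g_mul_klein_mul_g]
    rfl
  refine ⟨(2⁻¹ : ℂ) • (S1 + S2) - Complex.I • (2⁻¹ : ℂ) • (S1 - S2), ?_, ?_⟩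
  · have : B.kleinL ((2⁻¹ : ℂ) • (S1 + S2) - Complex.I • (2⁻¹ : ℂ) • (S1 - S2)) =
        evenPart B.γTwisted b - Complex.I • oddPart B.γTwisted b := by
      rw [evenPart_apply, oddPart_apply, LinearMap.map_sub, LinearMap.map_smul, LinearMap.map_smul,
        LinearMap.map_smul, LinearMap.map_sub, LinearMap.map_add, hk1, hk2]
    rw [this]
    exact parts_untwist B.γTwisted_γTwisted b
  · rw [← hb, B.klein_apply_Λ, B.gHalf_apply]
    change (2⁻¹ : ℂ) • (S B.Λ + B.g (S (B.g B.Λ))) -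
      Complex.I • (2⁻¹ : ℂ) • (S B.Λ - B.g (S (B.g B.Λ))) = _
    rw [B.g_Λ]

theorem IsFermiPlan.exists_channel {ω : Alg A.alg ⊗[ℂ] B.twisted →ₗ[ℂ] ℂ}
    (hω : IsFermiPlan A B ω) (a : Alg A.alg) :
    ∃ e : Alg B.alg, ∀ b : B.twisted,
      ω (a ⊗ₜ b) = ⟪B.Λ, (e : K →L[ℂ] K) ((b : K →L[ℂ] K) B.Λ)⟫_ℂ := by
  have hcyc : IsCyclic B.alg.commutant B.Λ := B.separating.isCyclic_commutant
  let τ : B.twisted →ₗ[ℂ] B.twisted := evenPart B.γTwisted + Complex.I • oddPart B.γTwisted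
  let φ : Alg A.alg → Alg B.alg.commutant →ₗ[ℂ] ℂ := fun a =>
    ω ∘ₗ TensorProduct.mk ℂ (Alg A.alg) B.twisted a ∘ₗ τ ∘ₗ B.kleinL
  have φ_apply : ∀ a b, φ a b = ω (a ⊗ₜ τ (B.kleinL b)) := fun _ _ => rfl
  have hφ : ∀ a : Alg A.alg, (a : H →L[ℂ] H).IsPositive → ∀ b, 0 ≤ φ a (star b * b) := by
    intro a ha b
    obtain ⟨c, hc, hca⟩ := exists_star_mul_self a.2 ha
    have : a = star (⟨c, hc⟩ : Alg A.alg) * ⟨c, hc⟩ := Subtype.ext hca.symm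
    rw [φ_apply, B.kleinL_star_mul, this]
    exact hω.toIsFermiState.untwisted_nonneg A.γ_γ B.γTwisted_γTwisted hω.map_γ _ _
  have hφ1 : ∀ b, φ 1 (star b * b) = (‖evalAt B.alg.commutant B.Λ b‖ ^ 2 : ℝ) := by
    intro b
    rw [φ_apply, hω.right]
    have h1 : ∀ z : B.twisted, B.μTwisted (B.γTwisted z) = B.μTwisted z := fun z => by
      change ⟪B.Λ, (B.γTwisted z : K →L[ℂ] K) B.Λ⟫_ℂ = ⟪B.Λ, (z : K →L[ℂ] K) B.Λ⟫_ℂ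
      rw [B.γTwisted_coe, mul_apply_eq_comp, mul_apply_eq_comp, B.g_Λ,
        ← ContinuousLinearMap.adjoint_inner_left B.g, ← ContinuousLinearMap.star_eq_adjoint,
        B.star_g, B.g_Λ]
    have h2 : ∀ z : B.twisted, B.μTwisted (τ z) = B.μTwisted z := fun z => by
      simp only [τ, LinearMap.add_apply, LinearMap.smul_apply, evenPart_apply, oddPart_apply,
        map_add, map_smul, map_sub, h1, sub_self, smul_zero, smul_eq_mul]
      ring
    rw [h2]
    change ⟪B.Λ, B.klein (star (b : K →L[ℂ] K) * b) B.Λ⟫_ℂ = _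
    rw [B.klein_apply_Λ, ← ContinuousLinearMap.adjoint_inner_left,
      ← ContinuousLinearMap.star_eq_adjoint, B.star_gHalf_Λ, mul_apply_eq_comp,
      ContinuousLinearMap.star_eq_adjoint, ContinuousLinearMap.adjoint_inner_right,
      inner_self_eq_norm_sq_to_K]
    norm_cast
  have main : ∀ S ∈ A.alg, ∃ T ∈ B.alg, ∀ hS : S ∈ A.alg, ∀ b : Alg B.alg.commutant,
      φ ⟨S, hS⟩ b = ⟪B.Λ, T ((b : K →L[ℂ] K) B.Λ)⟫_ℂ := by
    intro S hS
    refine induction_isPositive A.alg (fun S => ∃ T ∈ B.alg, ∀ hS : S ∈ A.alg,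
      ∀ b : Alg B.alg.commutant, φ ⟨S, hS⟩ b = ⟪B.Λ, T ((b : K →L[ℂ] K) B.Λ)⟫_ℂ) ?_ ?_ ?_ hS
    · intro S hS hp
      obtain ⟨T, hT, -, h⟩ := exists_commutant_of_dominated hcyc (φ ⟨S, hS⟩) ‖S‖
        (hφ ⟨S, hS⟩ hp) fun b => by
          have hmem : (‖S‖ : ℂ) • (1 : H →L[ℂ] H) - S ∈ A.alg :=
            sub_mem (A.alg.toStarSubalgebra.smul_mem (one_mem A.alg) _) hS
          have h1 := hφ ⟨_, hmem⟩ (norm_smul_one_sub_isPositive hp.isSelfAdjoint) b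
          have h2 : φ ⟨_, hmem⟩ (star b * b) =
              (‖S‖ : ℂ) * φ 1 (star b * b) - φ ⟨S, hS⟩ (star b * b) := by
            have : (⟨_, hmem⟩ : Alg A.alg) = (‖S‖ : ℂ) • (1 : Alg A.alg) - ⟨S, hS⟩ := rfl
            rw [φ_apply, φ_apply, φ_apply, this, TensorProduct.sub_tmul, map_sub,
              ← TensorProduct.smul_tmul', map_smul, smul_eq_mul]
          rw [h2, hφ1] at h1
          have h3 := (Complex.le_def.1 h1).1
          rw [← Complex.ofReal_mul, Complex.sub_re, Complex.ofReal_re, Complex.zero_re] at h3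
          linarith
      rw [VonNeumannAlgebra.commutant_commutant] at hT
      refine ⟨T, hT, fun _ b => ?_⟩
      have hcomm := VonNeumannAlgebra.mem_commutant_iff.1 b.2 T hT
      rw [h, ← mul_apply_eq_comp, ← mul_apply_eq_comp, hcomm]
    · rintro S hS S' hS' ⟨T, hT, h⟩ ⟨T', hT', h'⟩
      refine ⟨T + T', add_mem hT hT', fun _ b => ?_⟩
      have : (⟨S + S', add_mem hS hS'⟩ : Alg A.alg) = ⟨S, hS⟩ + ⟨S', hS'⟩ := rfl
      rw [this, φ_apply, TensorProduct.add_tmul, map_add, ← φ_apply, ← φ_apply, h hS, h' hS']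
      simp [inner_add_right]
    · rintro r S hS ⟨T, hT, h⟩
      refine ⟨r • T, B.alg.toStarSubalgebra.smul_mem hT r, fun hrS b => ?_⟩
      have : (⟨r • S, hrS⟩ : Alg A.alg) = r • ⟨S, hS⟩ := rfl
      rw [this, φ_apply, ← TensorProduct.smul_tmul', map_smul, ← φ_apply, h hS]
      simp [inner_smul_right]
  obtain ⟨T, hT, h⟩ := main a a.2
  refine ⟨⟨T, hT⟩, fun b => ?_⟩
  obtain ⟨S', hk, hΛ⟩ := B.exists_untwist b
  have := h a.2 S'
  rw [φ_apply, hΛ] at this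
  rw [← this]
  exact congrArg (fun z => ω (a ⊗ₜ z)) hk.symm

/-- The channel `E_ω : A → B` of a fermionic transport plan, determined by
`ω(a ⊗ b) = ⟨Λ_ν, E_ω(a) b Λ_ν⟩`; in other words, `ω = δ ∘ (E_ω ⊗ id)` for the fermionic diagonal
plan `δ(c ⊗ b) = ⟨Λ_ν, c b Λ_ν⟩`. -/
def IsFermiPlan.channel {ω : Alg A.alg ⊗[ℂ] B.twisted →ₗ[ℂ] ℂ} (hω : IsFermiPlan A B ω)
    (a : Alg A.alg) : Alg B.alg :=
  (hω.exists_channel a).choose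

theorem IsFermiPlan.apply_tmul {ω : Alg A.alg ⊗[ℂ] B.twisted →ₗ[ℂ] ℂ} (hω : IsFermiPlan A B ω)
    (a : Alg A.alg) (b : B.twisted) :
    ω (a ⊗ₜ b) = ⟪B.Λ, (hω.channel a : K →L[ℂ] K) ((b : K →L[ℂ] K) B.Λ)⟫_ℂ :=
  (hω.exists_channel a).choose_spec b

theorem GradedVN.denseRange_twisted (B : GradedVN K) :
    DenseRange fun b : B.twisted => (b : K →L[ℂ] K) B.Λ := by
  have hcyc := B.separating.isCyclic_commutant.denseRange
  have hg : Function.Surjective B.gHalf := fun y => ⟨(star B.gHalf : K →L[ℂ] K) y, by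
    rw [← mul_apply_eq_comp, gHalf_mul_star_gHalf]; rfl⟩
  refine (hg.denseRange.comp hcyc B.gHalf.continuous).mono ?_
  rintro _ ⟨b, rfl⟩
  exact ⟨B.kleinL b, B.klein_apply_Λ b⟩

/-- The channel is the only map that represents the plan. -/
theorem IsFermiPlan.channel_unique {ω : Alg A.alg ⊗[ℂ] B.twisted →ₗ[ℂ] ℂ}
    (hω : IsFermiPlan A B ω) (a : Alg A.alg) (e : Alg B.alg)
    (he : ∀ b : B.twisted, ω (a ⊗ₜ b) = ⟪B.Λ, (e : K →L[ℂ] K) ((b : K →L[ℂ] K) B.Λ)⟫_ℂ) :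
    e = hω.channel a := by
  have h : star (e : K →L[ℂ] K) B.Λ = star (hω.channel a : K →L[ℂ] K) B.Λ := by
    refine ext_inner_right ℂ fun z => ?_
    refine B.denseRange_twisted.induction_on z (isClosed_eq (by fun_prop) (by fun_prop))
      fun b => ?_
    rw [ContinuousLinearMap.star_eq_adjoint, ContinuousLinearMap.star_eq_adjoint,
      ContinuousLinearMap.adjoint_inner_left, ContinuousLinearMap.adjoint_inner_left, ← he,
      hω.apply_tmul]
  have h0 := B.separating _ (sub_mem (star_mem e.2) (star_mem (hω.channel a).2)) (by
    rw [_root_.sub_apply, h, sub_self])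
  exact Subtype.ext (star_injective (sub_eq_zero.1 h0))

end Plans

/-! The product of the two states is a plan, so that the set of plans is never empty. -/

section ProductState

variable {R : Type u} [Ring R] [StarRing R] [Algebra ℂ R] [StarModule ℂ R] {γA : R →⋆ₐ[ℂ] R}
variable {S : Type v} [Ring S] [StarRing S] [Algebra ℂ S] [StarModule ℂ S] {γB : S →⋆ₐ[ℂ] S}

/-- The product of two linear functionals. -/
def productFunctional (φ : R →ₗ[ℂ] ℂ) (ψ : S →ₗ[ℂ] ℂ) : R ⊗[ℂ] S →ₗ[ℂ] ℂ :=
  LinearMap.mul' ℂ ℂ ∘ₗ TensorProduct.map φ ψ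

theorem productFunctional_tmul (φ : R →ₗ[ℂ] ℂ) (ψ : S →ₗ[ℂ] ℂ) (a : R) (b : S) :
    productFunctional φ ψ (a ⊗ₜ b) = φ a * ψ b := rfl

theorem productFunctional_inner {E : Type u} [NormedAddCommGroup E] [InnerProductSpace ℂ E]
    {F : Type v} [NormedAddCommGroup F] [InnerProductSpace ℂ F]
    {φ : R →ₗ[ℂ] ℂ} {ψ : S →ₗ[ℂ] ℂ} {V : R →ₗ[ℂ] E} {W : S →ₗ[ℂ] F}
    (hV : ∀ a c, φ (star a * c) = ⟪V a, V c⟫_ℂ) (hW : ∀ b d, ψ (star b * d) = ⟪W b, W d⟫_ℂ)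
    (hφ : ∀ a, φ (γA a) = φ a) (hB : ∀ b, γB (γB b) = b) (c d : R ⊗[ℂ] S) :
    productFunctional φ ψ (fermiMul γA γB (fermiStar γA γB c) d) =
      ⟪TensorProduct.map V W c, TensorProduct.map V W d⟫_ℂ := by
  induction c with
  | zero => simp [fermiStar]
  | add x y hx hy => rw [fermiStar_add, map_add, LinearMap.add_apply, map_add, hx, hy, map_add,
      inner_add_left]
  | tmul a b =>
    induction d with
    | zero => simp
    | add x y hx hy => rw [map_add, map_add, hx, hy, map_add, inner_add_right]
    | tmul c d =>
      have h1 := map_evenPart hB b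
      have h2 := map_oddPart hB b
      have hs0 : γB (star (evenPart γB b)) = star (evenPart γB b) := by rw [map_star, h1]
      have hs1 : γB (star (oddPart γB b)) = -star (oddPart γB b) := by rw [map_star, h2, star_neg]
      rw [fermiStar_tmul, map_add, LinearMap.add_apply, fermiMul_tmul, fermiMul_tmul,
        evenPart_of_even hs0, oddPart_of_even hs0, evenPart_of_odd hs1, oddPart_of_odd hs1,
        zero_mul, TensorProduct.tmul_zero, TensorProduct.tmul_zero, add_zero, zero_add,
        map_add, productFunctional_tmul, productFunctional_tmul, ← map_star γA, ← map_mul γA, hφ,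
        ← mul_add, ← map_add, ← add_mul, ← star_add, evenPart_add_oddPart, hV, hW,
        TensorProduct.map_tmul, TensorProduct.map_tmul, TensorProduct.inner_tmul]

theorem productFunctional_nonneg {E : Type u} [NormedAddCommGroup E] [InnerProductSpace ℂ E]
    {F : Type v} [NormedAddCommGroup F] [InnerProductSpace ℂ F]
    {φ : R →ₗ[ℂ] ℂ} {ψ : S →ₗ[ℂ] ℂ} (V : R →ₗ[ℂ] E) (W : S →ₗ[ℂ] F)
    (hV : ∀ a c, φ (star a * c) = ⟪V a, V c⟫_ℂ) (hW : ∀ b d, ψ (star b * d) = ⟪W b, W d⟫_ℂ)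
    (hφ : ∀ a, φ (γA a) = φ a) (hB : ∀ b, γB (γB b) = b) (c : R ⊗[ℂ] S) :
    0 ≤ productFunctional φ ψ (fermiMul γA γB (fermiStar γA γB c) c) := by
  have key : ∀ z : E ⊗[ℂ] F, 0 ≤ ⟪z, z⟫_ℂ := fun z => by
    have : ⟪z, z⟫_ℂ = ((‖z‖ ^ 2 : ℝ) : ℂ) := by
      rw [Complex.ofReal_pow]
      exact inner_self_eq_norm_sq_to_K z
    rw [this, Complex.zero_le_real]
    exact sq_nonneg _
  rw [productFunctional_inner hV hW hφ hB]
  exact key _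

end ProductState

section ProductPlan

variable {H : Type u} [NormedAddCommGroup H] [InnerProductSpace ℂ H] [CompleteSpace H]
variable {K : Type v} [NormedAddCommGroup K] [InnerProductSpace ℂ K] [CompleteSpace K]

theorem GradedVN.μTwisted_one (B : GradedVN K) : B.μTwisted 1 = 1 := by
  have := B.faithfulNormal.map_one
  rw [B.μ_eq] at this
  exact this

theorem isFermiPlan_productFunctional (A : GradedVN H) (B : GradedVN K) :
    IsFermiPlan A B (productFunctional A.μ B.μTwisted) where
  map_one := by
    rw [productFunctional_tmul, A.faithfulNormal.map_one, B.μTwisted_one, one_mul]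
  nonneg c := by
    refine productFunctional_nonneg A.evalΛ
      ({ toFun := fun b => (b : K →L[ℂ] K) B.Λ
         map_add' := fun _ _ => rfl
         map_smul' := fun _ _ => rfl } : B.twisted →ₗ[ℂ] K)
      (fun a c => (A.inner_evalΛ a c).symm) (fun b d => ?_) A.μ_γ B.γTwisted_γTwisted c
    change ⟪B.Λ, (ContinuousLinearMap.adjoint (b : K →L[ℂ] K)) ((d : K →L[ℂ] K) B.Λ)⟫_ℂ = _
    rw [ContinuousLinearMap.adjoint_inner_right]
    rfl
  left a := by rw [productFunctional_tmul, B.μTwisted_one, mul_one]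
  right b := by rw [productFunctional_tmul, A.faithfulNormal.map_one, one_mul]
  balance a b := by
    have := B.gradingUP.isTwistedDual.inner_eq 1 b
    rw [B.gradingUP.map_one] at this
    rw [productFunctional_tmul, productFunctional_tmul, A.μ_γ]
    exact congrArg (A.μ a * ·) this.symm

end ProductPlan

/-! ### Systems and the fermionic Wasserstein distance -/

/-- A `ℤ₂`-graded system on `H` with dynamics indexed by `Υ` and `d` coordinates. -/
structure GradedSystem (H : Type u) [NormedAddCommGroup H] [InnerProductSpace ℂ H]
    [CompleteSpace H] (Υ : Type w) (d : ℕ) extends GradedVN H where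
  /-- the dynamics -/
  α : Υ → EvenUP toGradedVN toGradedVN
  /-- the coordinates -/
  k : Fin d → Alg toGradedVN.alg

namespace GradedSystem

variable {H : Type u} [NormedAddCommGroup H] [InnerProductSpace ℂ H] [CompleteSpace H]
variable {K : Type v} [NormedAddCommGroup K] [InnerProductSpace ℂ K] [CompleteSpace K]
variable {Υ : Type w} {d : ℕ}

/-- The fermionic transport plans from the system `A` to the system `B`. -/
def FermiPlans (A : GradedSystem H Υ d) (B : GradedSystem K Υ d) :
    Set (Alg A.alg ⊗[ℂ] B.twisted →ₗ[ℂ] ℂ) :=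
  {ω | IsFermiPlan A.toGradedVN B.toGradedVN ω ∧
    ∀ υ a b, ω ((A.α υ).map a ⊗ₜ b) = ω (a ⊗ₜ (B.α υ).twistedDual b)}

theorem nonempty_fermiPlans (A : GradedSystem H Υ d) (B : GradedSystem K Υ d) :
    (A.FermiPlans B).Nonempty := by
  refine ⟨productFunctional A.μ B.μTwisted,
    isFermiPlan_productFunctional A.toGradedVN B.toGradedVN, fun υ a b => ?_⟩
  have := (B.α υ).isTwistedDual.inner_eq 1 b
  rw [(B.α υ).map_one] at this
  rw [productFunctional_tmul, productFunctional_tmul, (A.α υ).state]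
  exact congrArg (A.μ a * ·) this.symm

/-- The cost of a fermionic transport plan. The sum is real; `re` only turns it into an element
of `ℝ`. -/
def cost (A : GradedSystem H Υ d) (B : GradedSystem K Υ d) (ω : A.FermiPlans B) : ℝ :=
  (∑ i, (A.μ (star (A.k i) * A.k i) + B.μ (star (B.k i) * B.k i)
    - B.μ (star (ω.2.1.channel (A.k i)) * B.k i)
    - B.μ (star (B.k i) * ω.2.1.channel (A.k i)))).re

/-- The fermionic Wasserstein distance `W^F(A, B)`. -/
def fermiW (A : GradedSystem H Υ d) (B : GradedSystem K Υ d) : ℝ :=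
  ⨅ ω : A.FermiPlans B, √(cost A B ω)

/-- `A` is hermitian: `{k₁*, …, k_d*} = {k₁, …, k_d}`. -/
def IsHermitian (A : GradedSystem H Υ d) : Prop :=
  Set.range (fun i => star (A.k i)) = Set.range A.k

/-- The von Neumann algebra of `A` is generated by the coordinates: it is contained in every
von Neumann algebra on `H` that contains them. -/
def GeneratedByCoords (A : GradedSystem H Υ d) : Prop :=
  ∀ M : VonNeumannAlgebra H, (∀ i, (A.k i : H →L[ℂ] H) ∈ M) → A.alg ≤ M

/-- `A` and `B` are isomorphic systems. -/
def Isomorphic (A : GradedSystem H Υ d) (B : GradedSystem K Υ d) : Prop :=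
  ∃ ι : Alg A.alg ≃⋆ₐ[ℂ] Alg B.alg,
    (∀ a, ι (A.γ a) = B.γ (ι a)) ∧ (∀ υ a, ι ((A.α υ).map a) = (B.α υ).map (ι a)) ∧
    (∀ a, B.μ (ι a) = A.μ a) ∧ ∀ i, ι (A.k i) = B.k i

end GradedSystem

end FermiTransport

end

/-!
A plan `ω` makes `(x, y) ↦ ω(x* y)` a positive semidefinite form on the Fermi tensor product, for
which `a Λ_μ ↦ a ⊗ 1` and `b Λ_ν ↦ 1 ⊗ b` are isometric. The Cauchy–Schwarz inequality therefore
bounds `ω` on simple tensors (`IsFermiPlan.norm_apply_tmul_le`), and this has two consequences.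
First, plans converge along ultrafilters (`GradedSystem.exists_tendsto_plan`) and the cost is
continuous, so that a vanishing distance is attained by a plan of cost zero
(`GradedSystem.exists_plan_pairCost_eq_zero`). Second, the channel `E` of a plan induces a
contraction `V : a Λ_μ ↦ E(a) Λ_ν`.

The cost of a plan at a pair of coordinates `k`, `l` is the squared distance between `k ⊗ 1` and the
limit of the `1 ⊗ c` as `c Λ_ν → l Λ_ν`. If it vanishes, then multiplication on the left by `a ⊗ b`
and the commutation relations between the algebra and its twisted commutant give
`E(a k) = E(a) l` for all `a` (`IsFermiPlan.channel_mul_of_pairCost_eq_zero`).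

For a hermitian system generated by its coordinates, a closed subspace that contains `Λ_μ` and is
invariant under the coordinates is everything (`GradedSystem.mem_of_invariant`). Applied to the
vectors `ξ` with `V a ξ = E(a) V ξ` for all `a`, this shows that a channel of cost zero is
multiplicative. Applied to the fixed vectors of `V' V`, where `V'` comes from a plan of cost zero in
the other direction, it shows that the two channels are inverse to each other. The channel preserves
the grading, the involution and the state for every plan, and intertwines the dynamics by the
condition on plans in `FermiPlans`.
-/

namespace FermiTransport

/-! ### The sesquilinear form of a state on the Fermi tensor product -/

section Form

variable {R : Type*} [Ring R] [StarRing R] [Algebra ℂ R] [StarModule ℂ R] {γA : R →⋆ₐ[ℂ] R}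
variable {S : Type*} [Ring S] [StarRing S] [Algebra ℂ S] [StarModule ℂ S] {γB : S →⋆ₐ[ℂ] S}

theorem fermiStar_smul (r : ℂ) (x : R ⊗[ℂ] S) :
    fermiStar γA γB (r • x) = conj r • fermiStar γA γB x := by
  simp only [fermiStar, map_smul, ← smul_add, star_smul]
  rfl

/-- The positive semidefinite form `(x, y) ↦ ω(x* y)`. -/
noncomputable abbrev IsFermiState.core {ω : R ⊗[ℂ] S →ₗ[ℂ] ℂ} (hω : IsFermiState γA γB ω) :
    PreInnerProductSpace.Core ℂ (R ⊗[ℂ] S) where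
  inner x y := ω (fermiMul γA γB (fermiStar γA γB x) y)
  conj_inner_symm x y := by
    -- Polarization: a sesquilinear form that is real on the diagonal is hermitian.
    have him : ∀ z : ℂ, 0 ≤ z → z.im = 0 := fun z hz => (Complex.le_def.1 hz).2.symm
    have h0 := him _ (hω.nonneg x)
    have h0' := him _ (hω.nonneg y)
    have h1 := him _ (hω.nonneg (x + y))
    have h2 := him _ (hω.nonneg (x + Complex.I • y))
    simp only [fermiStar_add, fermiStar_smul, map_add, LinearMap.add_apply, map_smul,
      LinearMap.smul_apply, smul_eq_mul, Complex.add_im, Complex.mul_im, Complex.mul_re,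
      Complex.add_re, Complex.I_re, Complex.I_im, Complex.conj_I, Complex.neg_re, Complex.neg_im,
      h0, h0']
      at h1 h2
    apply Complex.ext
    · simp only [Complex.conj_re]; linarith
    · simp only [Complex.conj_im]; linarith
  re_inner_nonneg x := (Complex.le_def.1 (hω.nonneg x)).1
  add_left x y z := by simp [fermiStar_add]
  smul_left x y r := by simp [fermiStar_smul]

theorem IsFermiState.conj_symm {ω : R ⊗[ℂ] S →ₗ[ℂ] ℂ} (hω : IsFermiState γA γB ω)
    (x y : R ⊗[ℂ] S) :
    ω (fermiMul γA γB (fermiStar γA γB x) y) =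
      conj (ω (fermiMul γA γB (fermiStar γA γB y) x)) :=
  (hω.core.conj_inner_symm x y).symm

theorem IsFermiState.norm_sq_le {ω : R ⊗[ℂ] S →ₗ[ℂ] ℂ} (hω : IsFermiState γA γB ω)
    (x y : R ⊗[ℂ] S) :
    ‖ω (fermiMul γA γB (fermiStar γA γB x) y)‖ ^ 2 ≤
      (ω (fermiMul γA γB (fermiStar γA γB x) x)).re *
        (ω (fermiMul γA γB (fermiStar γA γB y) y)).re := by
  have h := @InnerProductSpace.Core.inner_mul_inner_self_le ℂ (R ⊗[ℂ] S) _ _ _ hω.core x y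
  change ‖ω (fermiMul γA γB (fermiStar γA γB x) y)‖ *
    ‖ω (fermiMul γA γB (fermiStar γA γB y) x)‖ ≤ _ at h
  rw [hω.conj_symm y x, RCLike.norm_conj] at h
  rwa [sq]

theorem fermiStar_tmul_one (a : R) :
    fermiStar γA γB (a ⊗ₜ 1) = star a ⊗ₜ[ℂ] (1 : S) := by
  rw [fermiStar_tmul, evenPart_of_even (map_one γB), oddPart_of_even (map_one γB), star_one,
    star_zero, TensorProduct.tmul_zero, add_zero]

theorem fermiStar_one_tmul (b : S) :
    fermiStar γA γB (1 ⊗ₜ b) = (1 : R) ⊗ₜ[ℂ] star b := by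
  rw [fermiStar_tmul, map_one, ← TensorProduct.tmul_add, ← star_add, star_one,
    evenPart_add_oddPart]

theorem fermiMul_tmul_one_left (a : R) (c : R) (d : S) :
    fermiMul γA γB (a ⊗ₜ 1) (c ⊗ₜ d) = (a * c) ⊗ₜ[ℂ] d := by
  rw [fermiMul_tmul, evenPart_of_even (map_one γB), oddPart_of_even (map_one γB), one_mul,
    zero_mul, TensorProduct.tmul_zero, add_zero]

theorem fermiMul_one_tmul_right (a : R) (b d : S) :
    fermiMul γA γB (a ⊗ₜ b) (1 ⊗ₜ d) = a ⊗ₜ[ℂ] (b * d) := by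
  rw [fermiMul_tmul, map_one, mul_one, ← TensorProduct.tmul_add, ← add_mul,
    evenPart_add_oddPart]

theorem fermiStar_fermiStar_tmul (hA : ∀ a, γA (γA a) = a) (hB : ∀ b, γB (γB b) = b)
    (a : R) (b : S) : fermiStar γA γB (fermiStar γA γB (a ⊗ₜ b)) = a ⊗ₜ[ℂ] b := by
  have h0 : γB (star (evenPart γB b)) = star (evenPart γB b) := by
    rw [map_star, map_evenPart hB]
  have h1 : γB (star (oddPart γB b)) = -star (oddPart γB b) := by
    rw [map_star, map_oddPart hB, star_neg]
  rw [fermiStar_tmul, fermiStar_add, fermiStar_tmul, fermiStar_tmul, evenPart_of_even h0,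
    oddPart_of_even h0, evenPart_of_odd h1, oddPart_of_odd h1]
  simp only [star_zero, TensorProduct.tmul_zero, add_zero, zero_add, star_star, map_star, hA]
  rw [← TensorProduct.tmul_add, evenPart_add_oddPart]

/-- The Cauchy–Schwarz inequality for `ω(x* y)`, with `x*` a simple tensor. -/
theorem IsFermiState.norm_sq_tmul_mul_le {ω : R ⊗[ℂ] S →ₗ[ℂ] ℂ} (hω : IsFermiState γA γB ω)
    (hA : ∀ a, γA (γA a) = a) (hB : ∀ b, γB (γB b) = b) (a : R) (b : S) (y : R ⊗[ℂ] S) :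
    ‖ω (fermiMul γA γB (a ⊗ₜ b) y)‖ ^ 2 ≤
      (ω (fermiMul γA γB (a ⊗ₜ b) (fermiStar γA γB (a ⊗ₜ b)))).re *
        (ω (fermiMul γA γB (fermiStar γA γB y) y)).re := by
  have h := hω.norm_sq_le (fermiStar γA γB (a ⊗ₜ b)) y
  rwa [fermiStar_fermiStar_tmul hA hB] at h

/-- The form `ω(y* y)` at the difference `y = k ⊗ 1 - 1 ⊗ c` of the two embedded coordinates. -/
theorem IsFermiState.re_sub_eq {ω : R ⊗[ℂ] S →ₗ[ℂ] ℂ} (hω : IsFermiState γA γB ω)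
    (k : R) (c : S) :
    (ω (fermiMul γA γB (fermiStar γA γB (k ⊗ₜ 1 - 1 ⊗ₜ c)) (k ⊗ₜ 1 - 1 ⊗ₜ c))).re =
      (ω ((star k * k) ⊗ₜ 1)).re + (ω (1 ⊗ₜ (star c * c))).re - 2 * (ω (star k ⊗ₜ c)).re := by
  have hs : fermiStar γA γB (k ⊗ₜ[ℂ] (1 : S) - (1 : R) ⊗ₜ[ℂ] c) =
      fermiStar γA γB (k ⊗ₜ 1) - fermiStar γA γB (1 ⊗ₜ c) := by
    have := fermiStar_add γA γB (k ⊗ₜ[ℂ] (1 : S)) ((-1 : ℂ) • ((1 : R) ⊗ₜ[ℂ] c))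
    rw [fermiStar_smul] at this
    simpa [sub_eq_add_neg] using this
  have h1 : ω (fermiMul γA γB (fermiStar γA γB (k ⊗ₜ 1)) (1 ⊗ₜ c)) = ω (star k ⊗ₜ c) := by
    rw [fermiStar_tmul_one, fermiMul_tmul_one_left, mul_one]
  have h2 := hω.conj_symm (1 ⊗ₜ c) (k ⊗ₜ 1)
  rw [h1] at h2
  rw [hs]
  simp only [map_sub, LinearMap.sub_apply, h1, h2]
  rw [fermiStar_tmul_one, fermiMul_tmul_one_left, fermiStar_one_tmul, fermiMul_one_tmul_right]
  simp only [Complex.sub_re, Complex.conj_re]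
  ring

end Form

/-! ### Commutation relations of the twisted commutant -/

section Commutation

variable {K : Type*} [NormedAddCommGroup K] [InnerProductSpace ℂ K] [CompleteSpace K]

theorem GradedVN.g_mul_eq (B : GradedVN K) (x : Alg B.alg) :
    B.g * (x : K →L[ℂ] K) = B.γ x * B.g := by
  rw [← B.g_mul_mul_g, mul_assoc _ B.g B.g, B.g_mul_g, mul_one]

/-- The Klein isomorphism is `S ↦ S₊ - i S₋ g`, for the even and odd parts `S₊` and `S₋` of `S`. -/
theorem GradedVN.klein_eq (B : GradedVN K) (S : K →L[ℂ] K) :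
    B.klein S = (2⁻¹ : ℂ) • (S + B.g * S * B.g) -
      ((2⁻¹ : ℂ) * Complex.I) • ((S - B.g * S * B.g) * B.g) := by
  have h1 : (S - B.g * S * B.g) * B.g = S * B.g - B.g * S := by
    rw [sub_mul, mul_assoc _ B.g B.g, B.g_mul_g, mul_one]
  rw [h1, klein_apply, star_gHalf, gHalf, pPlus, pMinus]
  simp only [sub_mul, mul_add, mul_sub, add_mul, smul_mul_assoc, mul_smul_comm, smul_add,
    smul_sub, smul_smul, one_mul, mul_one, mul_assoc]
  match_scalars <;> ring_nf <;> simp <;> ring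

/-- Even elements of the twisted commutant commute with the algebra. -/
theorem GradedVN.commute_of_even (B : GradedVN K) {b : B.twisted} (hb : B.γTwisted b = b)
    (x : Alg B.alg) : (b : K →L[ℂ] K) * x = x * b := by
  obtain ⟨S, hS, hbS⟩ := B.mem_twisted.1 b.2
  have hT : S + B.g * S * B.g ∈ B.alg.commutant := add_mem hS (B.g_conj_mem_commutant hS)
  have hgg : B.g * (B.g * S * B.g) * B.g = S := by
    calc B.g * (B.g * S * B.g) * B.g = (B.g * B.g) * S * (B.g * B.g) := by simp only [mul_assoc]
      _ = S := by rw [B.g_mul_g, one_mul, mul_one]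
  have e : (b : K →L[ℂ] K) = (2⁻¹ : ℂ) • (S + B.g * S * B.g) := by
    have h1 : B.klein (B.g * S * B.g) = b := by
      rw [← B.g_mul_klein_mul_g, hbS, ← B.γTwisted_coe, hb]
    have h2 : (b : K →L[ℂ] K) = (2⁻¹ : ℂ) • (B.klein S + B.klein (B.g * S * B.g)) := by
      rw [h1, hbS]; module
    rw [h2, B.klein_eq, B.klein_eq, hgg]
    simp only [sub_mul]
    module
  rw [e, smul_mul_assoc, mul_smul_comm, VonNeumannAlgebra.mem_commutant_iff.1 hT x x.2]

/-- Odd elements of the twisted commutant commute with the algebra up to the grading: they are of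
the form `T g` with `T` in the commutant. -/
theorem GradedVN.twist_of_odd (B : GradedVN K) {b : B.twisted} (hb : B.γTwisted b = -b)
    (x : Alg B.alg) : (b : K →L[ℂ] K) * x = B.γ x * b := by
  obtain ⟨S, hS, hbS⟩ := B.mem_twisted.1 b.2
  have hT : S - B.g * S * B.g ∈ B.alg.commutant := sub_mem hS (B.g_conj_mem_commutant hS)
  have hgg : B.g * (B.g * S * B.g) * B.g = S := by
    calc B.g * (B.g * S * B.g) * B.g = (B.g * B.g) * S * (B.g * B.g) := by simp only [mul_assoc]
      _ = S := by rw [B.g_mul_g, one_mul, mul_one]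
  have e : (b : K →L[ℂ] K) =
      (-(2⁻¹ : ℂ) * Complex.I) • ((S - B.g * S * B.g) * B.g) := by
    have h1 : B.klein (B.g * S * B.g) = -b := by
      rw [← B.g_mul_klein_mul_g, hbS, ← B.γTwisted_coe, hb]
      rfl
    have h2 : (b : K →L[ℂ] K) = (2⁻¹ : ℂ) • (B.klein S - B.klein (B.g * S * B.g)) := by
      rw [h1, hbS]; module
    rw [h2, B.klein_eq, B.klein_eq, hgg]
    simp only [sub_mul]
    module
  rw [e, smul_mul_assoc, mul_smul_comm, mul_assoc _ B.g, B.g_mul_eq, ← mul_assoc, ← mul_assoc,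
    VonNeumannAlgebra.mem_commutant_iff.1 hT (B.γ x) (B.γ x).2]

/-- An element of the algebra is determined by its matrix elements against homogeneous elements
of the twisted commutant. -/
theorem GradedVN.eq_of_inner_homogeneous (B : GradedVN K) {x y : Alg B.alg}
    (h0 : ∀ b : B.twisted, B.γTwisted b = b → ⟪B.Λ, (x : K →L[ℂ] K) ((b : K →L[ℂ] K) B.Λ)⟫_ℂ =
      ⟪B.Λ, (y : K →L[ℂ] K) ((b : K →L[ℂ] K) B.Λ)⟫_ℂ)
    (h1 : ∀ b : B.twisted, B.γTwisted b = -b → ⟪B.Λ, (x : K →L[ℂ] K) ((b : K →L[ℂ] K) B.Λ)⟫_ℂ =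
      ⟪B.Λ, (y : K →L[ℂ] K) ((b : K →L[ℂ] K) B.Λ)⟫_ℂ) : x = y := by
  have h : star (x : K →L[ℂ] K) B.Λ = star (y : K →L[ℂ] K) B.Λ := by
    refine ext_inner_right ℂ fun z => ?_
    refine B.denseRange_twisted.induction_on z (isClosed_eq (by fun_prop) (by fun_prop))
      fun b => ?_
    rw [ContinuousLinearMap.star_eq_adjoint, ContinuousLinearMap.star_eq_adjoint,
      ContinuousLinearMap.adjoint_inner_left, ContinuousLinearMap.adjoint_inner_left,
      ← evenPart_add_oddPart (γ := B.γTwisted) b]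
    have e0 := h0 _ (map_evenPart B.γTwisted_γTwisted b)
    have e1 := h1 _ (map_oddPart B.γTwisted_γTwisted b)
    change ⟪B.Λ, (x : K →L[ℂ] K) (((evenPart B.γTwisted b : B.twisted) : K →L[ℂ] K) B.Λ +
      ((oddPart B.γTwisted b : B.twisted) : K →L[ℂ] K) B.Λ)⟫_ℂ =
      ⟪B.Λ, (y : K →L[ℂ] K) (((evenPart B.γTwisted b : B.twisted) : K →L[ℂ] K) B.Λ +
      ((oddPart B.γTwisted b : B.twisted) : K →L[ℂ] K) B.Λ)⟫_ℂ
    rw [map_add, map_add, inner_add_right, inner_add_right, e0, e1]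
  have h0 := B.separating _ (sub_mem (star_mem x.2) (star_mem y.2)) (by
    rw [_root_.sub_apply, h, sub_self])
  exact Subtype.ext (star_injective (sub_eq_zero.1 h0))

theorem GradedVN.evalΛ_injective (B : GradedVN K) : Function.Injective B.evalΛ := by
  intro x y h
  have := B.separating _ (sub_mem x.2 y.2) (by
    rw [_root_.sub_apply]; exact sub_eq_zero.2 h)
  exact Subtype.ext (sub_eq_zero.1 this)

theorem GradedVN.re_μ_star_mul_self (B : GradedVN K) (x : Alg B.alg) :
    (B.μ (star x * x)).re = ‖B.evalΛ x‖ ^ 2 := by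
  rw [← B.inner_evalΛ, inner_self_eq_norm_sq_to_K]
  norm_cast

theorem GradedVN.re_μTwisted_star_mul_self (B : GradedVN K) (b : B.twisted) :
    (B.μTwisted (star b * b)).re = ‖(b : K →L[ℂ] K) B.Λ‖ ^ 2 := by
  have : B.μTwisted (star b * b) = ⟪(b : K →L[ℂ] K) B.Λ, (b : K →L[ℂ] K) B.Λ⟫_ℂ := by
    rw [← ContinuousLinearMap.adjoint_inner_right]
    rfl
  rw [this, inner_self_eq_norm_sq_to_K]
  norm_cast

theorem GradedVN.g_apply_twisted (B : GradedVN K) (b : B.twisted) :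
    B.g ((b : K →L[ℂ] K) B.Λ) = (B.γTwisted b : K →L[ℂ] K) B.Λ := by
  rw [B.γTwisted_coe, mul_apply_eq_comp, mul_apply_eq_comp, B.g_Λ]

theorem GradedVN.inner_γ_odd (B : GradedVN K) {b : B.twisted} (hb : B.γTwisted b = -b)
    (x : Alg B.alg) : ⟪B.Λ, (B.γ x : K →L[ℂ] K) ((b : K →L[ℂ] K) B.Λ)⟫_ℂ =
      -⟪B.Λ, (x : K →L[ℂ] K) ((b : K →L[ℂ] K) B.Λ)⟫_ℂ := by
  rw [← B.inner_apply_g, B.g_apply_twisted, hb]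
  change ⟪B.Λ, (x : K →L[ℂ] K) (-((b : K →L[ℂ] K) B.Λ))⟫_ℂ = _
  rw [map_neg, inner_neg_right]

end Commutation

/-! ### The channel of a plan -/

section Channel

variable {H : Type*} [NormedAddCommGroup H] [InnerProductSpace ℂ H] [CompleteSpace H]
variable {K : Type*} [NormedAddCommGroup K] [InnerProductSpace ℂ K] [CompleteSpace K]
variable {A : GradedVN H} {B : GradedVN K} {ω : Alg A.alg ⊗[ℂ] B.twisted →ₗ[ℂ] ℂ}

namespace IsFermiPlan

/-- The channel of a plan as a linear map. -/
noncomputable def channelL (hω : IsFermiPlan A B ω) : Alg A.alg →ₗ[ℂ] Alg B.alg where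
  toFun := hω.channel
  map_add' x y := by
    refine (hω.channel_unique _ _ fun b => ?_).symm
    rw [TensorProduct.add_tmul, map_add, hω.apply_tmul, hω.apply_tmul, ← inner_add_right]
    rfl
  map_smul' r x := by
    refine (hω.channel_unique _ _ fun b => ?_).symm
    rw [← TensorProduct.smul_tmul', map_smul, hω.apply_tmul, smul_eq_mul, ← inner_smul_right]
    rfl

theorem channelL_apply (hω : IsFermiPlan A B ω) (a : Alg A.alg) :
    hω.channelL a = hω.channel a := rfl

theorem channel_one (hω : IsFermiPlan A B ω) : hω.channel 1 = 1 :=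
  (hω.channel_unique _ _ fun b => by rw [hω.right]; rfl).symm

theorem channel_γ (hω : IsFermiPlan A B ω) (a : Alg A.alg) :
    hω.channel (A.γ a) = B.γ (hω.channel a) :=
  (hω.channel_unique _ _ fun b => by
    rw [hω.map_γ, hω.apply_tmul, ← B.g_apply_twisted, B.inner_apply_g]).symm

theorem μ_channel (hω : IsFermiPlan A B ω) (a : Alg A.alg) : B.μ (hω.channel a) = A.μ a := by
  rw [← hω.left, hω.apply_tmul, B.μ_eq]
  rfl

theorem channel_star (hω : IsFermiPlan A B ω) (a : Alg A.alg) :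
    hω.channel (star a) = star (hω.channel a) := by
  -- `ω` is hermitian for the twisted involution, whose sign is undone by the twisted commutation.
  have key : ∀ b : B.twisted, ω (star a ⊗ₜ b) =
      conj (ω (a ⊗ₜ evenPart B.γTwisted (star b)) + ω (A.γ a ⊗ₜ oddPart B.γTwisted (star b))) := by
    intro b
    have h := hω.conj_symm (a ⊗ₜ 1) (1 ⊗ₜ b)
    rw [fermiStar_tmul_one, fermiMul_tmul_one_left, fermiStar_one_tmul, fermiMul_tmul, mul_one,
      mul_one, mul_one, one_mul, one_mul, map_add] at h
    exact h
  have hinner : ∀ (x : Alg B.alg) (b : B.twisted),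
      conj ⟪B.Λ, (x : K →L[ℂ] K) (((star b : B.twisted) : K →L[ℂ] K) B.Λ)⟫_ℂ =
        ⟪B.Λ, ((b : K →L[ℂ] K) * (star x : Alg B.alg)) B.Λ⟫_ℂ := by
    intro x b
    rw [inner_conj_symm, ← ContinuousLinearMap.adjoint_inner_right]
    change ⟪ContinuousLinearMap.adjoint (b : K →L[ℂ] K) B.Λ, _⟫_ℂ = _
    rw [ContinuousLinearMap.adjoint_inner_left]
    rfl
  refine B.eq_of_inner_homogeneous (fun b hb => ?_) fun b hb => ?_
  · have hs : B.γTwisted (star b) = star b := by rw [map_star, hb]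
    rw [← hω.apply_tmul, key, evenPart_of_even hs, oddPart_of_even hs, TensorProduct.tmul_zero,
      map_zero, add_zero, hω.apply_tmul, hinner, B.commute_of_even hb]
    rfl
  · have hs : B.γTwisted (star b) = -star b := by rw [map_star, hb, star_neg]
    rw [← hω.apply_tmul, key, evenPart_of_odd hs, oddPart_of_odd hs, TensorProduct.tmul_zero,
      map_zero, zero_add, hω.apply_tmul, hinner, B.twist_of_odd hb, hω.channel_γ, ← map_star,
      B.γ_γ]
    rfl

theorem norm_apply_tmul_le (hω : IsFermiPlan A B ω) (a : Alg A.alg) (b : B.twisted) :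
    ‖ω (a ⊗ₜ b)‖ ≤ ‖A.evalΛ (star a)‖ * ‖(b : K →L[ℂ] K) B.Λ‖ := by
  have h := hω.norm_sq_le (star a ⊗ₜ 1) (1 ⊗ₜ b)
  simp only [fermiStar_tmul_one, fermiMul_tmul_one_left, fermiStar_one_tmul,
    fermiMul_one_tmul_right, star_star, hω.left, hω.right] at h
  have h1 := A.re_μ_star_mul_self (star a)
  rw [star_star] at h1
  rw [h1, B.re_μTwisted_star_mul_self, ← mul_pow] at h
  exact le_of_sq_le_sq h (by positivity)

/-- The values of a plan on simple tensors are inner products of `E(a*) Λ_ν` with `b Λ_ν`. -/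
theorem apply_tmul_eq_inner (hω : IsFermiPlan A B ω) (a : Alg A.alg) (b : B.twisted) :
    ω (a ⊗ₜ b) = ⟪B.evalΛ (hω.channel (star a)), (b : K →L[ℂ] K) B.Λ⟫_ℂ := by
  rw [hω.apply_tmul, hω.channel_star, ← ContinuousLinearMap.adjoint_inner_left]
  rfl

/-- The Kadison–Schwarz inequality `ν(E(a)* E(a)) ≤ μ(a* a)`. -/
theorem norm_evalΛ_channel_le (hω : IsFermiPlan A B ω) (a : Alg A.alg) :
    ‖B.evalΛ (hω.channel a)‖ ≤ ‖A.evalΛ a‖ := by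
  have h : ∀ z : K, ‖⟪B.evalΛ (hω.channel a), z⟫_ℂ‖ ≤ ‖A.evalΛ a‖ * ‖z‖ := fun z => by
    refine B.denseRange_twisted.induction_on z (isClosed_le (by fun_prop) (by fun_prop))
      fun b => ?_
    have := hω.norm_apply_tmul_le (star a) b
    rwa [hω.apply_tmul_eq_inner, star_star] at this
  have h1 := h (B.evalΛ (hω.channel a))
  rw [inner_self_eq_norm_sq_to_K, norm_pow, RCLike.norm_ofReal, abs_norm, sq] at h1
  by_contra hlt
  push Not at hlt
  nlinarith [norm_nonneg (A.evalΛ a)]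

/-- The contraction `a Λ_μ ↦ E(a) Λ_ν`. -/
noncomputable def contraction (hω : IsFermiPlan A B ω) : H →L[ℂ] K :=
  (B.evalΛ ∘ₗ hω.channelL).extendOfNorm A.evalΛ

theorem contraction_evalΛ (hω : IsFermiPlan A B ω) (a : Alg A.alg) :
    hω.contraction (A.evalΛ a) = B.evalΛ (hω.channel a) :=
  LinearMap.extendOfNorm_eq A.denseRange_evalΛ
    ⟨1, fun a => by rw [one_mul]; exact hω.norm_evalΛ_channel_le a⟩ a

/-- The cost of a plan at one pair of coordinates, written with norms and inner products in the
standard Hilbert spaces. -/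
noncomputable def pairCost (hω : IsFermiPlan A B ω) (k : Alg A.alg) (l : Alg B.alg) : ℝ :=
  ‖A.evalΛ k‖ ^ 2 + ‖B.evalΛ l‖ ^ 2 - 2 * (⟪B.evalΛ (hω.channel k), B.evalΛ l⟫_ℂ).re

theorem pairCost_nonneg (hω : IsFermiPlan A B ω) (k : Alg A.alg) (l : Alg B.alg) :
    0 ≤ hω.pairCost k l := by
  have h1 := @norm_sub_sq ℂ _ _ _ _ (B.evalΛ (hω.channel k)) (B.evalΛ l)
  have h2 := sq_nonneg ‖B.evalΛ (hω.channel k) - B.evalΛ l‖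
  have h3 := pow_le_pow_left₀ (norm_nonneg _) (hω.norm_evalΛ_channel_le k) 2
  change _ = _ - 2 * (⟪B.evalΛ (hω.channel k), B.evalΛ l⟫_ℂ).re + _ at h1
  rw [pairCost]
  linarith

/-- At zero cost, `k ⊗ 1` and `l` have the same image in the GNS space of `ω`, where `l Λ_ν` is
approximated by `c Λ_ν` with `c` in the twisted commutant. -/
theorem apply_tmul_of_pairCost_eq_zero (hω : IsFermiPlan A B ω) {k : Alg A.alg} {l : Alg B.alg}
    (h : hω.pairCost k l = 0) (a : Alg A.alg) (b : B.twisted) :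
    ω ((a * k) ⊗ₜ evenPart B.γTwisted b) + ω ((a * A.γ k) ⊗ₜ oddPart B.γTwisted b) =
      ⟪B.Λ, (hω.channel a : K →L[ℂ] K) ((b : K →L[ℂ] K) (B.evalΛ l))⟫_ℂ := by
  obtain ⟨z, hz⟩ : ∃ z, z = ω ((a * k) ⊗ₜ evenPart B.γTwisted b) +
      ω ((a * A.γ k) ⊗ₜ oddPart B.γTwisted b) := ⟨_, rfl⟩
  obtain ⟨C, hC⟩ : ∃ C, C = (ω (fermiMul A.γ B.γTwisted (a ⊗ₜ b)
      (fermiStar A.γ B.γTwisted (a ⊗ₜ b)))).re := ⟨_, rfl⟩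
  rw [← hz]
  have bound : ∀ η : K,
      ‖z - ⟪B.Λ, (hω.channel a : K →L[ℂ] K) ((b : K →L[ℂ] K) η)⟫_ℂ‖ ^ 2 ≤
        C * (‖A.evalΛ k‖ ^ 2 + ‖η‖ ^ 2 - 2 * RCLike.re ⟪B.evalΛ (hω.channel k), η⟫_ℂ) := by
    intro η
    refine B.denseRange_twisted.induction_on η (isClosed_le (by fun_prop) (by fun_prop))
      fun c => ?_
    have h1 := hω.norm_sq_tmul_mul_le A.γ_γ B.γTwisted_γTwisted a b (k ⊗ₜ 1 - 1 ⊗ₜ c)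
    have h4 : ω (fermiMul A.γ B.γTwisted (a ⊗ₜ b) (k ⊗ₜ 1 - 1 ⊗ₜ c)) =
        z - ⟪B.Λ, (hω.channel a : K →L[ℂ] K) ((b : K →L[ℂ] K) ((c : K →L[ℂ] K) B.Λ))⟫_ℂ := by
      rw [map_sub, map_sub, fermiMul_one_tmul_right, hω.apply_tmul a, fermiMul_tmul, map_add,
        mul_one, mul_one, ← hz]
      rfl
    have h5 := congrArg Complex.re (hω.apply_tmul_eq_inner (star k) c)
    rw [star_star] at h5
    have h6 := (hω.re_sub_eq k c).trans (congrArg₂ (· - ·)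
      (congrArg₂ (· + ·) ((congrArg Complex.re (hω.left _)).trans (A.re_μ_star_mul_self k))
        ((congrArg Complex.re (hω.right _)).trans (B.re_μTwisted_star_mul_self c))) (congrArg (2 * ·) h5))
    rw [h4, ← hC, h6] at h1
    exact h1
  have h1 := bound (B.evalΛ l)
  change _ ≤ C * hω.pairCost k l at h1
  rw [h, mul_zero] at h1
  exact sub_eq_zero.1 (norm_eq_zero.1 (pow_eq_zero_iff two_ne_zero |>.1
    (le_antisymm h1 (sq_nonneg _))))

/-- At zero cost, `k` lies in the multiplicative domain of the channel and is mapped to `l`. -/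
theorem channel_mul_of_pairCost_eq_zero (hω : IsFermiPlan A B ω) {k : Alg A.alg} {l : Alg B.alg}
    (h : hω.pairCost k l = 0) (a : Alg A.alg) : hω.channel (a * k) = hω.channel a * l := by
  refine B.eq_of_inner_homogeneous (fun b hb => ?_) fun b hb => ?_
  · have h1 := hω.apply_tmul_of_pairCost_eq_zero h a b
    rw [evenPart_of_even hb, oddPart_of_even hb, TensorProduct.tmul_zero, map_zero, add_zero,
      hω.apply_tmul, B.evalΛ_apply, ← mul_apply_eq_comp (b : K →L[ℂ] K), B.commute_of_even hb]
      at h1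
    exact h1
  · -- For odd `b` the relation holds with `γ(k)` and `γ(l)`; applying it to `γ(a)` and using
    -- the invariance under the grading turns it into the relation for `k` and `l`.
    have h1 := hω.apply_tmul_of_pairCost_eq_zero h (A.γ a) b
    rw [evenPart_of_odd hb, oddPart_of_odd hb, TensorProduct.tmul_zero, map_zero, zero_add,
      hω.apply_tmul, B.evalΛ_apply, ← mul_apply_eq_comp (b : K →L[ℂ] K), B.twist_of_odd hb,
      ← map_mul, hω.channel_γ, B.inner_γ_odd hb, hω.channel_γ] at h1
    have h2 := B.inner_γ_odd hb (hω.channel a * l)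
    rw [map_mul] at h2
    exact neg_injective (h1.trans h2)

end IsFermiPlan

end Channel

/-! ### Existence of optimal plans -/

section Optimal

variable {H : Type*} [NormedAddCommGroup H] [InnerProductSpace ℂ H] [CompleteSpace H]
variable {K : Type*} [NormedAddCommGroup K] [InnerProductSpace ℂ K] [CompleteSpace K]
variable {Υ : Type*} {d : ℕ}

/-- Each summand of the cost is the `pairCost` of the coordinates. -/
theorem IsFermiPlan.re_cost_eq_pairCost {A : GradedVN H} {B : GradedVN K}
    {ω : Alg A.alg ⊗[ℂ] B.twisted →ₗ[ℂ] ℂ} (hω : IsFermiPlan A B ω)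
    (k : Alg A.alg) (l : Alg B.alg) :
    (A.μ (star k * k) + B.μ (star l * l) - B.μ (star (hω.channel k) * l) -
      B.μ (star l * hω.channel k)).re = hω.pairCost k l := by
  have h : (B.μ (star l * hω.channel k)).re =
      (⟪B.evalΛ (hω.channel k), B.evalΛ l⟫_ℂ).re := by
    rw [← B.inner_evalΛ, ← inner_conj_symm, Complex.conj_re]
  rw [IsFermiPlan.pairCost, Complex.sub_re, Complex.sub_re, Complex.add_re, A.re_μ_star_mul_self,
    B.re_μ_star_mul_self, h, B.inner_evalΛ]
  ring

namespace GradedSystem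

open Filter Topology

theorem cost_eq_sum (A : GradedSystem H Υ d) (B : GradedSystem K Υ d) (ω : A.FermiPlans B) :
    cost A B ω = ∑ i, ω.2.1.pairCost (A.k i) (B.k i) := by
  rw [cost, Complex.re_sum]
  exact Finset.sum_congr rfl fun i _ => ω.2.1.re_cost_eq_pairCost (A.k i) (B.k i)

/-- Plans converge along ultrafilters, because `|ω(a ⊗ b)| ≤ ‖a* Λ_μ‖ ‖b Λ_ν‖` for all plans. -/
theorem exists_tendsto_plan (A : GradedSystem H Υ d) (B : GradedSystem K Υ d)
    (u : ℕ → A.FermiPlans B) (F : Ultrafilter ℕ) :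
    ∃ ω : A.FermiPlans B, ∀ x, Tendsto (fun n => (u n).1 x) F (𝓝 (ω.1 x)) := by
  have hbdd : ∀ x, ∃ C : ℝ, ∀ n, ‖(u n).1 x‖ ≤ C := by
    intro x
    induction x with
    | zero => exact ⟨0, fun n => by simp⟩
    | tmul a b => exact ⟨_, fun n => (u n).2.1.norm_apply_tmul_le a b⟩
    | add x y hx hy =>
      obtain ⟨C, hC⟩ := hx
      obtain ⟨D, hD⟩ := hy
      exact ⟨C + D, fun n => by rw [map_add]; exact norm_add_le_of_le (hC n) (hD n)⟩
  have hlim : ∀ x, ∃ z : ℂ, Tendsto (fun n => (u n).1 x) F (𝓝 z) := by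
    intro x
    obtain ⟨C, hC⟩ := hbdd x
    obtain ⟨z, -, hz⟩ := (isCompact_closedBall (0 : ℂ) C).ultrafilter_le_nhds
      (F.map fun n => (u n).1 x) (by
        rw [le_principal_iff, Ultrafilter.mem_coe, Ultrafilter.mem_map]
        exact univ_mem' fun n => by simpa using hC n)
    exact ⟨z, hz⟩
  choose f hf using hlim
  let ω : Alg A.alg ⊗[ℂ] B.twisted →ₗ[ℂ] ℂ :=
    { toFun := f
      map_add' := fun x y => tendsto_nhds_unique (hf (x + y)) (by
        simpa only [map_add] using (hf x).add (hf y))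
      map_smul' := fun r x => tendsto_nhds_unique (hf (r • x)) (by
        simpa only [map_smul, RingHom.id_apply] using (hf x).const_smul r) }
  have hω : ∀ x, Tendsto (fun n => (u n).1 x) F (𝓝 (ω x)) := hf
  have hconst : ∀ x z, (∀ n, (u n).1 x = z) → ω x = z := fun x z h =>
    tendsto_nhds_unique (hω x) (by simp only [h]; exact tendsto_const_nhds)
  have heq : ∀ x y, (∀ n, (u n).1 x = (u n).1 y) → ω x = ω y := fun x y h =>
    tendsto_nhds_unique (hω x) (by simp only [h]; exact hω y)
  refine ⟨⟨ω, ⟨⟨⟨hconst _ _ fun n => (u n).2.1.map_one, fun c => ?_⟩,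
    fun a => hconst _ _ fun n => (u n).2.1.left a,
    fun b => hconst _ _ fun n => (u n).2.1.right b,
    fun a b => heq _ _ fun n => (u n).2.1.balance a b⟩,
    fun υ a b => heq _ _ fun n => (u n).2.2 υ a b⟩⟩, hω⟩
  exact ge_of_tendsto' (hω _) fun n => (u n).2.1.nonneg c

/-- Bounded vectors converge weakly as soon as their inner products with a dense set converge. -/
theorem tendsto_inner_of_denseRange {K : Type*} [NormedAddCommGroup K] [InnerProductSpace ℂ K]
    {X ι : Type*} {f : X → K} (hf : DenseRange f) {F : Filter ι} {v : ι → K} {w : K} {C : ℝ}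
    (hv : ∀ n, ‖v n‖ ≤ C) (hw : ‖w‖ ≤ C)
    (h : ∀ b, Tendsto (fun n => ⟪v n, f b⟫_ℂ) F (𝓝 ⟪w, f b⟫_ℂ)) (η : K) :
    Tendsto (fun n => ⟪v n, η⟫_ℂ) F (𝓝 ⟪w, η⟫_ℂ) := by
  rw [Metric.tendsto_nhds]
  intro ε hε
  have hC0 : 0 ≤ C := (norm_nonneg _).trans hw
  obtain ⟨b, hbη⟩ := hf.exists_dist_lt η (ε := ε / (3 * (C + 1))) (by positivity)
  rw [dist_eq_norm] at hbη
  have hsmall : ∀ x : K, ‖x‖ ≤ C → ‖⟪x, η⟫_ℂ - ⟪x, f b⟫_ℂ‖ ≤ ε / 3 := fun x hx => by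
    rw [← inner_sub_right]
    calc _ ≤ ‖x‖ * ‖η - f b‖ := norm_inner_le_norm _ _
      _ ≤ (C + 1) * (ε / (3 * (C + 1))) := by gcongr; linarith
      _ = ε / 3 := by field_simp
  filter_upwards [(Metric.tendsto_nhds.1 (h b)) (ε / 3) (by positivity)] with n hn
  have h1 := hsmall _ (hv n)
  have h2 := hsmall _ hw
  rw [dist_eq_norm] at hn ⊢
  calc ‖⟪v n, η⟫_ℂ - ⟪w, η⟫_ℂ‖
      = ‖(⟪v n, η⟫_ℂ - ⟪v n, f b⟫_ℂ) + (⟪v n, f b⟫_ℂ - ⟪w, f b⟫_ℂ) -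
          (⟪w, η⟫_ℂ - ⟪w, f b⟫_ℂ)‖ := by congr 1; ring
    _ ≤ ‖⟪v n, η⟫_ℂ - ⟪v n, f b⟫_ℂ‖ + ‖⟪v n, f b⟫_ℂ - ⟪w, f b⟫_ℂ‖ +
          ‖⟪w, η⟫_ℂ - ⟪w, f b⟫_ℂ‖ :=
      (norm_sub_le _ _).trans (by gcongr; exact norm_add_le _ _)
    _ < ε := by linarith

/-- The cost is continuous along ultrafilters: the vectors `E_ω(a) Λ_ν` are bounded by `‖a Λ_μ‖`
and their inner products with the dense set of vectors `b Λ_ν` are values of `ω`. -/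
theorem tendsto_inner_channel (A : GradedSystem H Υ d) (B : GradedSystem K Υ d)
    {u : ℕ → A.FermiPlans B} {F : Ultrafilter ℕ} {ω : A.FermiPlans B}
    (h : ∀ x, Tendsto (fun n => (u n).1 x) F (𝓝 (ω.1 x))) (a : Alg A.alg) (η : K) :
    Tendsto (fun n => ⟪B.evalΛ ((u n).2.1.channel a), η⟫_ℂ) F
      (𝓝 ⟪B.evalΛ (ω.2.1.channel a), η⟫_ℂ) := by
  have hb : ∀ b : B.twisted,
      Tendsto (fun n => ⟪B.evalΛ ((u n).2.1.channel a), (b : K →L[ℂ] K) B.Λ⟫_ℂ) F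
        (𝓝 ⟪B.evalΛ (ω.2.1.channel a), (b : K →L[ℂ] K) B.Λ⟫_ℂ) := fun b => by
    have hval : ∀ ω' : A.FermiPlans B, ω'.1 (star a ⊗ₜ b) =
        ⟪B.evalΛ (ω'.2.1.channel a), (b : K →L[ℂ] K) B.Λ⟫_ℂ := fun ω' => by
      have := ω'.2.1.apply_tmul_eq_inner (star a) b
      rwa [star_star] at this
    rw [← hval ω]
    exact (h (star a ⊗ₜ b)).congr fun n => hval (u n)
  exact tendsto_inner_of_denseRange B.denseRange_twisted
    (fun n => (u n).2.1.norm_evalΛ_channel_le a) (ω.2.1.norm_evalΛ_channel_le a) hb η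

/-- A vanishing distance is attained: an ultrafilter limit of plans whose costs tend to zero has
cost zero at every coordinate. -/
theorem exists_plan_pairCost_eq_zero {A : GradedSystem H Υ d} {B : GradedSystem K Υ d}
    (hW : A.fermiW B = 0) :
    ∃ ω : A.FermiPlans B, ∀ i, ω.2.1.pairCost (A.k i) (B.k i) = 0 := by
  have : Nonempty (A.FermiPlans B) := (A.nonempty_fermiPlans B).to_subtype
  have hnn : ∀ (ω : A.FermiPlans B) i, 0 ≤ ω.2.1.pairCost (A.k i) (B.k i) :=
    fun ω i => ω.2.1.pairCost_nonneg _ _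
  have hex : ∀ n : ℕ, ∃ ω : A.FermiPlans B, √(cost A B ω) < 1 / (n + 1 : ℝ) := fun n =>
    exists_lt_of_ciInf_lt (by rw [fermiW] at hW; rw [hW]; positivity)
  choose u hu using hex
  let F : Ultrafilter ℕ := hyperfilter ℕ
  have hF : (F : Filter ℕ) ≤ atTop := by
    rw [← Nat.cofinite_eq_atTop]; exact hyperfilter_le_cofinite
  obtain ⟨ω, hω⟩ := exists_tendsto_plan A B u F
  refine ⟨ω, fun i => ?_⟩
  have h1 : Tendsto (fun n => (u n).2.1.pairCost (A.k i) (B.k i)) F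
      (𝓝 (ω.2.1.pairCost (A.k i) (B.k i))) :=
    tendsto_const_nhds.sub (((Complex.continuous_re.tendsto _).comp
      (tendsto_inner_channel A B hω (A.k i) (B.evalΛ (B.k i)))).const_mul 2)
  have h2 : Tendsto (fun n : ℕ => (1 / (n + 1 : ℝ)) ^ 2) F (𝓝 0) := by
    simpa using ((tendsto_one_div_add_atTop_nhds_zero_nat (𝕜 := ℝ)).mono_left hF).pow 2
  refine tendsto_nhds_unique h1 (squeeze_zero (fun n => hnn _ i) (fun n => ?_) h2)
  have h3 : (u n).2.1.pairCost (A.k i) (B.k i) ≤ cost A B (u n) := by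
    rw [cost_eq_sum]
    exact Finset.single_le_sum (f := fun i => (u n).2.1.pairCost (A.k i) (B.k i))
      (fun j _ => hnn _ j) (Finset.mem_univ i)
  exact h3.trans ((Real.sqrt_le_left (by positivity)).1 (hu n).le)

end GradedSystem

end Optimal

/-! ### Generation by the coordinates -/

section Generation

variable {H : Type*} [NormedAddCommGroup H] [InnerProductSpace ℂ H] [CompleteSpace H]
variable {Υ : Type*} {d : ℕ}

/-- The commutant of a selfadjoint operator, as a von Neumann algebra. -/
def commutantOfSelfAdjoint (P : H →L[ℂ] H) (hP : IsSelfAdjoint P) : VonNeumannAlgebra H where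
  carrier := Set.centralizer {P}
  mul_mem' ha hb := Set.mul_mem_centralizer ha hb
  one_mem' := Set.one_mem_centralizer
  add_mem' ha hb := Set.add_mem_centralizer ha hb
  zero_mem' := Set.zero_mem_centralizer
  algebraMap_mem' r := by
    rw [Set.mem_centralizer_iff]
    exact fun T _ => (Algebra.commutes r T).symm
  star_mem' {T} hT := by
    rw [Set.mem_centralizer_iff] at hT ⊢
    intro Q hQ
    rw [Set.mem_singleton_iff.1 hQ]
    have := congrArg star (hT P rfl)
    rw [star_mul, star_mul, hP.star_eq] at this
    exact this.symm
  centralizer_centralizer' := Set.centralizer_centralizer_centralizer {P}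

theorem mem_commutantOfSelfAdjoint {P : H →L[ℂ] H} {hP : IsSelfAdjoint P} {T : H →L[ℂ] H} :
    T ∈ commutantOfSelfAdjoint P hP ↔ P * T = T * P := by
  change T ∈ Set.centralizer {P} ↔ _
  simp [Set.mem_centralizer_iff]

/-- In a hermitian system generated by its coordinates, a closed subspace that contains `Λ_μ` and
is invariant under the coordinates is the whole space: its projection lies in the commutant, for
which `Λ_μ` is separating. -/
theorem GradedSystem.mem_of_invariant {A : GradedSystem H Υ d} (hA : A.IsHermitian)
    (hAg : A.GeneratedByCoords) {V : Submodule ℂ H} (hV : IsClosed (V : Set H)) (hΛ : A.Λ ∈ V)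
    (hk : ∀ i, ∀ ξ ∈ V, (A.k i : H →L[ℂ] H) ξ ∈ V) (ξ : H) : ξ ∈ V := by
  have : CompleteSpace V := hV.completeSpace_coe
  set P := V.starProjection with hP
  have hPs : IsSelfAdjoint P := isStarProjection_starProjection.isSelfAdjoint
  have hPV : ∀ {η}, η ∈ V ↔ P η = η := Submodule.starProjection_eq_self_iff.symm
  have hPP : ∀ η, P η ∈ V := fun η => V.starProjection_apply_mem η
  -- A range that is invariant under `k_i` gives `P k_i P = k_i P`.
  have h1 : ∀ i, P * (A.k i : H →L[ℂ] H) * P = A.k i * P := fun i => by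
    ext η
    exact hPV.1 (hk i _ (hPP η))
  have h2 : ∀ i, P * (A.k i : H →L[ℂ] H) = A.k i * P := fun i => by
    obtain ⟨j, hj⟩ : star (A.k i) ∈ Set.range A.k := hA ▸ ⟨i, rfl⟩
    have e := congrArg star (h1 j)
    have hs : star (A.k j : H →L[ℂ] H) = A.k i := by
      have := congrArg (fun a : Alg A.alg => star (a : H →L[ℂ] H)) hj
      exact this.trans (star_star _)
    rw [star_mul, star_mul, star_mul, hPs.star_eq, hs, ← mul_assoc, h1] at e
    exact e.symm
  have h3 : A.alg ≤ commutantOfSelfAdjoint P hPs :=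
    hAg _ fun i => mem_commutantOfSelfAdjoint.2 (h2 i)
  have h4 : P = 1 := by
    ext η
    refine A.denseRange_evalΛ.induction_on η (isClosed_eq (by fun_prop) (by fun_prop))
      fun a => ?_
    have := mem_commutantOfSelfAdjoint.1 (h3 a.2)
    rw [A.evalΛ_apply, ← mul_apply_eq_comp, this, mul_apply_eq_comp, hPV.1 hΛ]
    rfl
  exact hPV.2 (by rw [h4]; rfl)

end Generation

/-! ### Plans of cost zero -/

section CostZero

variable {H : Type*} [NormedAddCommGroup H] [InnerProductSpace ℂ H] [CompleteSpace H]
variable {K : Type*} [NormedAddCommGroup K] [InnerProductSpace ℂ K] [CompleteSpace K]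
variable {Υ : Type*} {d : ℕ} {A : GradedSystem H Υ d} {B : GradedSystem K Υ d}

theorem IsFermiPlan.contraction_Λ {A : GradedVN H} {B : GradedVN K}
    {ω : Alg A.alg ⊗[ℂ] B.twisted →ₗ[ℂ] ℂ} (hω : IsFermiPlan A B ω) :
    hω.contraction A.Λ = B.Λ := by
  have := hω.contraction_evalΛ 1
  rw [hω.channel_one] at this
  exact this

namespace GradedSystem

theorem channel_coord {ω : A.FermiPlans B} (hω : ∀ i, ω.2.1.pairCost (A.k i) (B.k i) = 0)
    (i : Fin d) : ω.2.1.channel (A.k i) = B.k i := by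
  have := ω.2.1.channel_mul_of_pairCost_eq_zero (hω i) 1
  rwa [one_mul, ω.2.1.channel_one, one_mul] at this

/-- The contraction of a plan of cost zero intertwines the channel. -/
theorem contraction_apply (hA : A.IsHermitian) (hAg : A.GeneratedByCoords) {ω : A.FermiPlans B}
    (hω : ∀ i, ω.2.1.pairCost (A.k i) (B.k i) = 0) (a : Alg A.alg) (ξ : H) :
    ω.2.1.contraction ((a : H →L[ℂ] H) ξ) =
      (ω.2.1.channel a : K →L[ℂ] K) (ω.2.1.contraction ξ) := by
  set V := ω.2.1.contraction with hVdef
  let W : Submodule ℂ H :=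
    { carrier := {ξ | ∀ a : Alg A.alg,
        V ((a : H →L[ℂ] H) ξ) = (ω.2.1.channel a : K →L[ℂ] K) (V ξ)}
      add_mem' := fun hx hy a => by simp only [map_add, hx a, hy a]
      zero_mem' := fun a => by simp only [map_zero]
      smul_mem' := fun r x hx a => by simp only [map_smul, hx a] }
  have hW : IsClosed (W : Set H) := by
    change IsClosed {ξ | ∀ a : Alg A.alg,
      V ((a : H →L[ℂ] H) ξ) = (ω.2.1.channel a : K →L[ℂ] K) (V ξ)}
    rw [Set.ofPred_forall]
    exact isClosed_iInter fun a => isClosed_eq (by fun_prop) (by fun_prop)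
  refine mem_of_invariant hA hAg hW (fun a => ?_) (fun i ξ hξ a => ?_) ξ a
  · rw [ω.2.1.contraction_Λ]
    exact ω.2.1.contraction_evalΛ a
  · have h1 := hξ (a * A.k i)
    rw [ω.2.1.channel_mul_of_pairCost_eq_zero (hω i)] at h1
    rw [hξ (A.k i), channel_coord hω]
    exact h1

theorem channel_mul (hA : A.IsHermitian) (hAg : A.GeneratedByCoords) {ω : A.FermiPlans B}
    (hω : ∀ i, ω.2.1.pairCost (A.k i) (B.k i) = 0) (a b : Alg A.alg) :
    ω.2.1.channel (a * b) = ω.2.1.channel a * ω.2.1.channel b := by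
  refine B.evalΛ_injective ?_
  rw [← ω.2.1.contraction_evalΛ]
  change ω.2.1.contraction ((a : H →L[ℂ] H) (A.evalΛ b)) = _
  rw [contraction_apply hA hAg hω, ω.2.1.contraction_evalΛ]
  rfl

/-- Channels of cost zero in the two directions are inverse to each other: the composition of
their contractions fixes `Λ_μ` and commutes with the coordinates. -/
theorem channel_channel (hA : A.IsHermitian) (hAg : A.GeneratedByCoords) (hB : B.IsHermitian)
    (hBg : B.GeneratedByCoords) {ω : A.FermiPlans B} {ω' : B.FermiPlans A}
    (hω : ∀ i, ω.2.1.pairCost (A.k i) (B.k i) = 0)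
    (hω' : ∀ i, ω'.2.1.pairCost (B.k i) (A.k i) = 0) (a : Alg A.alg) :
    ω'.2.1.channel (ω.2.1.channel a) = a := by
  let W : Submodule ℂ H := LinearMap.ker
    ((ω'.2.1.contraction ∘L ω.2.1.contraction - ContinuousLinearMap.id ℂ H : H →L[ℂ] H) :
      H →ₗ[ℂ] H)
  have hmem : ∀ ξ, ξ ∈ W ↔ ω'.2.1.contraction (ω.2.1.contraction ξ) = ξ := fun ξ =>
    sub_eq_zero
  have hW : IsClosed (W : Set H) := ContinuousLinearMap.isClosed_ker _
  have hall : ∀ ξ, ξ ∈ W := mem_of_invariant hA hAg hW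
    (by rw [hmem, ω.2.1.contraction_Λ, ω'.2.1.contraction_Λ]) fun i ξ hξ => by
      rw [hmem] at hξ ⊢
      rw [contraction_apply hA hAg hω, channel_coord hω, contraction_apply hB hBg hω',
        channel_coord hω', hξ]
  refine A.evalΛ_injective ?_
  have h := (hmem _).1 (hall (A.evalΛ a))
  rwa [ω.2.1.contraction_evalΛ, ω'.2.1.contraction_evalΛ] at h

theorem channel_dynamics (ω : A.FermiPlans B) (υ : Υ) (a : Alg A.alg) :
    ω.2.1.channel ((A.α υ).map a) = (B.α υ).map (ω.2.1.channel a) :=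
  (ω.2.1.channel_unique _ _ fun b => by
    rw [ω.2.2, ω.2.1.apply_tmul, (B.α υ).isTwistedDual.inner_eq]).symm

end GradedSystem

end CostZero

end FermiTransport

/-! ### Isomorphism of systems at distance zero -/

open FermiTransport FermiTransport.GradedSystem in
theorem proposition6p7
    {H : Type*} [NormedAddCommGroup H] [InnerProductSpace ℂ H] [CompleteSpace H]
    {K : Type*} [NormedAddCommGroup K] [InnerProductSpace ℂ K] [CompleteSpace K]
    {Υ : Type*} {d : ℕ} (hd : 1 ≤ d)
    (A : FermiTransport.GradedSystem H Υ d) (B : FermiTransport.GradedSystem K Υ d)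
    (hA : A.IsHermitian) (hB : B.IsHermitian)
    (hAg : A.GeneratedByCoords) (hBg : B.GeneratedByCoords)
    (hAB : A.fermiW B = 0) (hBA : B.fermiW A = 0) :
    A.Isomorphic B := by
  obtain ⟨ω, hω⟩ := exists_plan_pairCost_eq_zero hAB
  obtain ⟨ω', hω'⟩ := exists_plan_pairCost_eq_zero hBA
  let ι : Alg A.alg ≃⋆ₐ[ℂ] Alg B.alg :=
    { toFun := ω.2.1.channel
      invFun := ω'.2.1.channel
      left_inv := channel_channel hA hAg hB hBg hω hω'
      right_inv := channel_channel hB hBg hA hAg hω' hω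
      map_mul' := channel_mul hA hAg hω
      map_add' := ω.2.1.channelL.map_add
      map_star' := ω.2.1.channel_star
      map_smul' := ω.2.1.channelL.map_smul }
  exact ⟨ι, ω.2.1.channel_γ, channel_dynamics ω, ω.2.1.μ_channel, channel_coord hω⟩
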